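/- Let $n\ge 2$ and $m\ge 0$ be integers, let $\Omega\subset\mathbb{R}^n$ be a bounded open set (connected or not) with infinitely differentiable boundary: every $z\in\partial\Omega$ has an open neighbourhood $U$ with a $C^\infty$ diffeomorphism $\Phi$ of $U$ onto an open subset of $\mathbb{R}^{n-1}\times\mathbb{R}$ such that $\Phi(U\cap\Omega)=\Phi(U)\cap\{(t,s): s>0\}$. Let $f\in C^m(\overline\Omega)$ be real- or complex-valued, i.e. $f$ is $m$ times continuously differentiable in $\Omega$, and $f$ and its derivatives of order at most $m$ extend continuously to $\overline\Omega$. Let \[ N(x,y)=\begin{cases}\dfrac{1}{\omega_n}\,\dfrac{|x-y|^{2-n}}{2-n}, & n>2,\\[2mm] \dfrac1{2\pi}\log|x-y|, & n=2,\end{cases} \qquad V[f](x)=\int_\Omega N(x,y)f(y)\,dy ,\quad x\in\overline\Omega, \] where $\omega_n$ is the surface area of the unit sphere in $\mathbb{R}^n$. Then the integral defining $V[f](x)$ converges absolutely for every $x\in\overline\Omega$, and the restriction of the Newtonian potential to the boundary satisfies $V[f]|_{\partial\Omega}\in C^{m+1}(\partial\Omega)$; that is, for every diffeomorphism $\Phi:U\to\Phi(U)$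 as above, the function $t\mapsto V[f](\Phi^{-1}(t,0))$ is $m+1$ times continuously differentiable on the open set $\{t\in\mathbb{R}^{n-1}:(t,0)\in\Phi(U)\}$. -/

import Mathlib

open MeasureTheory Set
open scoped ContDiff

noncomputable section

/-- A boundary (straightening) chart of a set `Ω ⊆ ℝⁿ`: a `C^∞` diffeomorphism `Φ` from an open
subset of `ℝⁿ` onto an open subset of `ℝⁿ⁻¹ × ℝ` which carries the part of `Ω` in its source
exactly to the part of its target lying in the open half space `{(t, s) : s > 0}`. Since `Φ` is a
homeomorphism, the part of `∂Ω` in the source is then exactly `{Φ⁻¹ (t, 0)}`. -/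
structure IsBoundaryChart {n : ℕ} (Ω : Set (EuclideanSpace ℝ (Fin n)))
    (Φ : OpenPartialHomeomorph (EuclideanSpace ℝ (Fin n))
      (EuclideanSpace ℝ (Fin (n - 1)) × ℝ)) : Prop where
  contDiffOn : ContDiffOn ℝ ∞ Φ Φ.source
  contDiffOn_symm : ContDiffOn ℝ ∞ Φ.symm Φ.target
  mem_iff : ∀ x ∈ Φ.source, x ∈ Ω ↔ 0 < (Φ x).2

/-- The boundary of `Ω` is infinitely differentiable (with `Ω` locally on one side of it): there
is a boundary chart around every boundary point. -/
def HasSmoothBoundary {n : ℕ} (Ω : Set (EuclideanSpace ℝ (Fin n))) : Prop :=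
  ∀ z ∈ frontier Ω, ∃ Φ : OpenPartialHomeomorph (EuclideanSpace ℝ (Fin n))
    (EuclideanSpace ℝ (Fin (n - 1)) × ℝ), z ∈ Φ.source ∧ IsBoundaryChart Ω Φ

/-- `f ∈ C^m(Ω̄)` for an open set `Ω`: `f` is `m` times continuously differentiable in `Ω`, and
`f` and its derivatives of all orders up to `m` extend continuously from `Ω` to `Ω̄`.
Only the values of `f` in `Ω` matter. -/
def IsContDiffUpToBoundary {n : ℕ} {𝕜 : Type*} [RCLike 𝕜] (m : ℕ)
    (Ω : Set (EuclideanSpace ℝ (Fin n))) (f : EuclideanSpace ℝ (Fin n) → 𝕜) : Prop :=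
  ContDiffOn ℝ m f Ω ∧
    ∀ k ≤ m, ∃ G : EuclideanSpace ℝ (Fin n) → (EuclideanSpace ℝ (Fin n)) [×k]→L[ℝ] 𝕜,
      ContinuousOn G (closure Ω) ∧ EqOn (iteratedFDeriv ℝ k f) G Ω

/-- `g|_{∂Ω} ∈ C^k(∂Ω)` for a set `Ω` with smooth boundary: `g` is `k` times continuously
differentiable in the local coordinates `t` of the hypersurface `∂Ω` given by
`t ↦ Φ⁻¹ (t, 0)`, for every boundary chart `Φ`. Only the values of `g` on `∂Ω` matter. -/
def IsContDiffOnBoundary {n : ℕ} {𝕜 : Type*} [RCLike 𝕜] (k : ℕ)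
    (Ω : Set (EuclideanSpace ℝ (Fin n))) (g : EuclideanSpace ℝ (Fin n) → 𝕜) : Prop :=
  ∀ Φ : OpenPartialHomeomorph (EuclideanSpace ℝ (Fin n)) (EuclideanSpace ℝ (Fin (n - 1)) × ℝ),
    IsBoundaryChart Ω Φ →
      ContDiffOn ℝ k (fun t : EuclideanSpace ℝ (Fin (n - 1)) => g (Φ.symm (t, (0 : ℝ))))
        {t | (t, (0 : ℝ)) ∈ Φ.target}

/-- The surface area `ω_n` of the unit sphere of `ℝⁿ`. -/
def unitSphereArea (n : ℕ) : ℝ :=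
  (volume : Measure (EuclideanSpace ℝ (Fin n))).toSphere.real univ

/-- The fundamental solution `N(x, y)` of the Laplace operator in `ℝⁿ`, `n ≥ 2`
(the value at `x = y` is immaterial). -/
def newtonKernel (n : ℕ) (x y : EuclideanSpace ℝ (Fin n)) : ℝ :=
  if n = 2 then 1 / (2 * Real.pi) * Real.log ‖x - y‖
  else 1 / unitSphereArea n * (‖x - y‖ ^ (2 - (n : ℤ)) / (2 - (n : ℝ)))

/-- The Newtonian (Poisson) potential `V[f](x) = ∫_Ω N(x, y) f(y) dy`. -/
def newtonPotential {n : ℕ} {𝕜 : Type*} [RCLike 𝕜] (Ω : Set (EuclideanSpace ℝ (Fin n)))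
    (f : EuclideanSpace ℝ (Fin n) → 𝕜) (x : EuclideanSpace ℝ (Fin n)) : 𝕜 :=
  ∫ y in Ω, newtonKernel n x y • f y

end

/-! The density is bounded but jumps across `∂Ω`, so the potential cannot be differentiated freely
in all directions; along the boundary it can. A cutoff around a boundary point splits the density.
The part away from the point contributes a smooth function
(`contDiffAt_integral_newtonKernel_of_eq_zero`). The part near it is pulled back by a straightening
chart with inverse `Ψ`, and the substitution `y = ι t - z` gives `∫ K (t, z) F (ι t - z) dz` with `K
(t, z) = N (Ψ (ι t), Ψ (ι t - z))`, where `ι` embeds the boundary coordinates and `F` is the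
pulled-back density times the Jacobian, cut off to a half space.

Two facts make this form work. The half space is invariant under translations along `ι`, so `F` has
`m` bounded tangential derivatives despite its jump (`IsBoundedContDiffOn.isTangentiallyBounded`).
And differentiating `K` in `t` at fixed `z` does not worsen its singularity at `z = 0`: the
differences of components of `Ψ` have order one and so do all their `t`-derivatives
(`IsParamKernel.difference`), and products, powers and logarithms preserve this
(`exists_isParamKernel_newtonKernel`).

Hence `m` derivatives can be distributed over `K` and `F` at no cost (`contDiff_paramIntegral`). The
extra derivative falls entirely on the kernel, where it costs one order and stays integrable
(`contDiff_one_paramIntegral`); there `F` need only be bounded and measurable. -/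

set_option linter.unusedSectionVars false

/-! ### Integrability of power singularities. -/

section SingularIntegrals

open Metric Filter Topology

variable {X : Type*} [NormedAddCommGroup X] [NormedSpace ℝ X] [FiniteDimensional ℝ X]
  [MeasurableSpace X] [BorelSpace X] {μ : Measure X} [μ.IsAddHaarMeasure]
  {V W Y : Type*} [NormedAddCommGroup V] [NormedSpace ℝ V] [NormedAddCommGroup W] [NormedSpace ℝ W]
  [NormedAddCommGroup Y] [NormedSpace ℝ Y]

theorem aestronglyMeasurable_of_continuousOn_compl_zero [Nontrivial X] {G : X → W}
    (hG : ContinuousOn G {0}ᶜ) : AEStronglyMeasurable G μ := by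
  have h := hG.aestronglyMeasurable (μ := μ) (measurableSet_singleton 0).compl
  rwa [Measure.restrict_eq_self_of_ae_mem] at h
  rw [ae_iff]
  simp

theorem integrableOn_norm_rpow_ball [Nontrivial X] {p : ℝ} (hp : -(Module.finrank ℝ X : ℝ) < p)
    (r : ℝ) : IntegrableOn (fun z : X => ‖z‖ ^ p) (ball 0 r) μ := by
  refine integrableOn_ball_of_norm_le_rpow (C := 1) (α := -p) Module.finrank_pos (by linarith) ?_ ?_
  · refine Eventually.of_forall fun z => ?_
    rw [neg_neg, one_mul, Real.norm_of_nonneg (by positivity)]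
  · exact (measurable_norm.pow_const p).aestronglyMeasurable

theorem integrable_of_norm_le_rpow [Nontrivial X] {G : X → W} {p C R : ℝ}
    (hp : -(Module.finrank ℝ X : ℝ) < p)
    (hG : ContinuousOn G {0}ᶜ) (hsupp : ∀ z, R < ‖z‖ → G z = 0)
    (hb : ∀ z ≠ 0, ‖G z‖ ≤ C * ‖z‖ ^ p) : Integrable G μ := by
  have hm := aestronglyMeasurable_of_continuousOn_compl_zero (μ := μ) hG
  have h := integrableOn_ball_of_norm_le_rpow (μ := μ) (C := C) (α := -p) (r := R + 1) (f := G)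
    Module.finrank_pos (by linarith) (ae_restrict_of_ae ?_) hm
  · rw [← integrableOn_univ]
    refine h.of_forall_sdiff_eq_zero MeasurableSet.univ fun z hz => hsupp z ?_
    have : ¬ ‖z‖ < R + 1 := by simpa using hz.2
    linarith
  · have : ∀ᵐ z ∂μ, z ≠ 0 := by
      rw [ae_iff]
      simp
    filter_upwards [this] with z hz
    rw [neg_neg]
    exact hb z hz

theorem integrable_bilin_of_bounded
    (B : V →L[ℝ] W →L[ℝ] Y) {F : X → V} {G : X → W}
    (hF : AEStronglyMeasurable F μ) {M : ℝ} (hM : ∀ y, ‖F y‖ ≤ M) (hG : Integrable G μ) :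
    Integrable (fun z => B (F z) (G z)) μ := by
  refine (hG.norm.const_mul (‖B‖ * M)).mono' (B.aestronglyMeasurable_comp₂ hF hG.1) ?_
  refine Eventually.of_forall fun z => (B.le_opNorm₂ _ _).trans ?_
  gcongr
  exact hM z

/-- The balls decrease to a null set. The radii are those outside which the truncations of
`exists_truncation` agree with the kernel, so this limit controls the truncation error. -/
theorem tendsto_setIntegral_closedBall_rpow [Nontrivial X] {p : ℝ}
    (hp : -(Module.finrank ℝ X : ℝ) < p) :
    Tendsto (fun j : ℕ => ∫ z in closedBall (0 : X) (2 / ((j : ℝ) + 1)), ‖z‖ ^ p ∂μ)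
      atTop (𝓝 0) := by
  have hanti : Antitone fun j : ℕ => closedBall (0 : X) (2 / ((j : ℝ) + 1)) := by
    intro i j hij
    refine closedBall_subset_closedBall ?_
    gcongr
  have h := tendsto_setIntegral_of_antitone (μ := μ) (f := fun z : X => ‖z‖ ^ p)
    (fun j : ℕ => measurableSet_closedBall) hanti
    ⟨0, (integrableOn_norm_rpow_ball hp 3).mono_set (closedBall_subset_ball (by norm_num))⟩
  convert h using 2
  symm
  refine setIntegral_measure_zero _ ?_
  refine measure_mono_null (t := {0}) ?_ (by simp)
  intro z hz
  rw [mem_iInter] at hz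
  have h1 : Tendsto (fun j : ℕ => 2 / ((j : ℝ) + 1)) atTop (𝓝 0) := by
    have := (tendsto_one_div_add_atTop_nhds_zero_nat (𝕜 := ℝ)).const_mul 2
    simpa [div_eq_mul_inv] using this
  have h2 : ‖z‖ ≤ 0 := ge_of_tendsto' h1 fun j => by simpa using hz j
  simpa using h2

end SingularIntegrals

/-! ### Singular kernels with a parameter, and the case of a smooth kernel. -/

section Kernels

open Metric Filter Topology
open scoped Convolution

variable {E X : Type*} [NormedAddCommGroup E] [NormedSpace ℝ E] [FiniteDimensional ℝ E]
  [NormedAddCommGroup X] [NormedSpace ℝ X] [FiniteDimensional ℝ X]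

/-- `K (t, z)` is smooth on `D`, of size `‖z‖ ^ p`, with derivative of size `‖z‖ ^ (p - 1)`. -/
def IsSingularKernel (D : Set (E × X)) (p : ℝ) (K : E × X → ℝ) : Prop :=
  ContDiffOn ℝ ∞ K D ∧ ∃ C, ∀ x ∈ D, |K x| ≤ C * ‖x.2‖ ^ p ∧ ‖fderiv ℝ K x‖ ≤ C * ‖x.2‖ ^ (p - 1)

/-- `K (t, z)` and its derivatives of order at most `k` with respect to `t` are singular
kernels of the same order `p` on `D`. -/
def IsParamKernel (D : Set (E × X)) (p : ℝ) : ℕ → (E × X → ℝ) → Prop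
  | 0, K => IsSingularKernel D p K
  | k + 1, K => IsSingularKernel D p K ∧
      ∀ v : E, IsParamKernel D p k fun x => fderiv ℝ K x (v, 0)

theorem IsParamKernel.isSingularKernel {D : Set (E × X)} {p : ℝ} {k : ℕ} {K : E × X → ℝ}
    (h : IsParamKernel D p k K) : IsSingularKernel D p K := by
  cases k with
  | zero => exact h
  | succ k => exact h.1

variable {𝕜 : Type*} [RCLike 𝕜]

/-- The derivatives of `F : X → 𝕜` of order at most `m` along the image of `ι : E →L[ℝ] X`
exist everywhere, and are measurable and bounded. -/
def IsTangentiallyBounded [MeasurableSpace X] (ι : E →L[ℝ] X) : ℕ → (X → 𝕜) → Prop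
  | 0, F => Measurable F ∧ ∃ C, ∀ y, ‖F y‖ ≤ C
  | m + 1, F => (Measurable F ∧ ∃ C, ∀ y, ‖F y‖ ≤ C) ∧
      ∃ F' : X → E →L[ℝ] 𝕜, (∀ y, HasFDerivAt (fun t => F (y + ι t)) (F' y) 0) ∧
        (∃ C, ∀ y, ‖F' y‖ ≤ C) ∧ ∀ v, IsTangentiallyBounded ι m fun y => F' y v

theorem IsTangentiallyBounded.bounded [MeasurableSpace X] {ι : E →L[ℝ] X} {m : ℕ} {F : X → 𝕜}
    (h : IsTangentiallyBounded ι m F) : Measurable F ∧ ∃ C, ∀ y, ‖F y‖ ≤ C := by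
  cases m with
  | zero => exact h
  | succ k => exact h.1

variable [MeasurableSpace X] [BorelSpace X] (μ : Measure X) [μ.IsAddHaarMeasure]

/-- The integral `∫ K (t, z) F (ι t - z) dz`. -/
noncomputable def paramIntegral (ι : E →L[ℝ] X) (K : E × X → ℝ) (F : X → 𝕜) (t : E) : 𝕜 :=
  ∫ z, K (t, z) • F (ι t - z) ∂μ

/-- The derivative of `paramIntegral`, with the derivative falling on the kernel. -/
noncomputable def paramIntegralDeriv (ι : E →L[ℝ] X) (K : E × X → ℝ) (F : X → 𝕜) (t : E) : E →L[ℝ] 𝕜 :=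
  (∫ z, (((ContinuousLinearMap.lsmul ℝ ℝ : ℝ →L[ℝ] 𝕜 →L[ℝ] 𝕜).flip.precompR (E × X))
    (F (ι t - z))) (fderiv ℝ K (t, z)) ∂μ).comp ((ContinuousLinearMap.id ℝ E).prod ι)

variable {μ}

theorem locallyIntegrable_of_bounded {F : X → 𝕜} (hF : Measurable F ∧ ∃ C, ∀ y, ‖F y‖ ≤ C) :
    LocallyIntegrable F μ := by
  obtain ⟨hm, C, hC⟩ := hF
  exact (locallyIntegrable_const C).mono hm.aestronglyMeasurable
    (Eventually.of_forall fun y => (hC y).trans (le_abs_self C))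

/-- The integral is the convolution of `F` with `K (t, ·)` evaluated at `ι t`, that is, a
convolution with parameter composed with `t ↦ (t, ι t)`. All derivatives fall on the kernel, so no
regularity of `F` is needed. -/
theorem hasFDerivAt_paramIntegral_of_contDiff (ι : E →L[ℝ] X) {K : E × X → ℝ} {F : X → 𝕜} {R : ℝ}
    (hK : ContDiff ℝ ∞ K) (hsupp : ∀ x : E × X, R < ‖x.2‖ → K x = 0)
    (hF : Measurable F ∧ ∃ C, ∀ y, ‖F y‖ ≤ C) :
    (∀ t, HasFDerivAt (paramIntegral μ ι K F) (paramIntegralDeriv μ ι K F t) t) ∧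
      Continuous (paramIntegralDeriv μ ι K F) := by
  set L : 𝕜 →L[ℝ] ℝ →L[ℝ] 𝕜 := (ContinuousLinearMap.lsmul ℝ ℝ : ℝ →L[ℝ] 𝕜 →L[ℝ] 𝕜).flip
  set g : E → X → ℝ := fun t z => K (t, z)
  have hgK : ↿g = K := rfl
  have hs : ∀ t : E, ∀ z : X, t ∈ (univ : Set E) → z ∉ closedBall (0 : X) R → g t z = 0 := by
    intro t z _ hz
    exact hsupp _ (by simpa using hz)
  have hloc := locallyIntegrable_of_bounded (μ := μ) hF
  have hu : paramIntegral μ ι K F = (fun q : E × X => (F ⋆[L, μ] g q.1) q.2) ∘ fun t => (t, ι t) := by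
    ext t
    simp only [Function.comp, paramIntegral]
    rw [convolution_eq_swap]
    rfl
  have hder : ∀ t, HasFDerivAt (paramIntegral μ ι K F) (paramIntegralDeriv μ ι K F t) t := by
    intro t
    have h := hasFDerivAt_convolution_right_with_param (μ := μ) L isOpen_univ
      (isCompact_closedBall (0 : X) R) hs hloc
      (by rw [hgK]; exact (hK.of_le (by exact_mod_cast le_top)).contDiffOn) (t, ι t) (mem_univ _)
    have h2 := h.comp t (((ContinuousLinearMap.id ℝ E).prod ι).hasFDerivAt (x := t))
    rw [convolution_eq_swap] at h2
    rw [hu]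
    exact h2
  refine ⟨hder, ?_⟩
  have hc : ContDiff ℝ 1 (paramIntegral μ ι K F) := by
    have h := contDiffOn_convolution_right_with_param (μ := μ) (n := 1) L isOpen_univ
      (isCompact_closedBall (0 : X) R) hs hloc
      (by rw [hgK]; exact (hK.of_le (by exact_mod_cast le_top)).contDiffOn)
    rw [univ_prod_univ, contDiffOn_univ] at h
    rw [hu]
    exact h.comp (contDiff_id.prodMk ι.contDiff)
  have h3 := hc.continuous_fderiv one_ne_zero
  convert h3 using 1
  ext1 t
  exact (hder t).fderiv.symm

end Kernels

/-! ### Smooth truncation of a kernel near its singularity. -/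

section Kernels

open Metric Filter Topology

variable {E X : Type*} [NormedAddCommGroup E] [NormedSpace ℝ E] [FiniteDimensional ℝ E]
  [NormedAddCommGroup X] [NormedSpace ℝ X] [FiniteDimensional ℝ X]
variable {𝕜 : Type*} [RCLike 𝕜]
variable [MeasurableSpace X] [BorelSpace X] {μ : Measure X} [μ.IsAddHaarMeasure]

theorem isOpen_snd_ne_zero : IsOpen {x : E × X | x.2 ≠ 0} :=
  isOpen_ne.preimage continuous_snd

/-- Multiply `K` by `1 - b ((j + 1) z)` for a bump `b`. The derivative of the cutoff has size `j +
1`, but only matters where `‖z‖ ≤ 2 / (j + 1)`; there `j + 1 ≤ 2 / ‖z‖`, so the product rule gives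
bounds of the original orders with a constant independent of `j`. -/
theorem exists_truncation {p : ℝ} {K : E × X → ℝ}
    (hK : IsSingularKernel {x : E × X | x.2 ≠ 0} p K) :
    ∃ C : ℝ, 0 ≤ C ∧ ∃ T : ℕ → E × X → ℝ, ∀ j, ContDiff ℝ ∞ (T j) ∧ (∀ x, K x = 0 → T j x = 0) ∧
      (∀ x : E × X, 2 / ((j : ℝ) + 1) < ‖x.2‖ → T j =ᶠ[𝓝 x] K) ∧
      ∀ x : E × X, x.2 ≠ 0 →
        |T j x| ≤ C * ‖x.2‖ ^ p ∧ ‖fderiv ℝ (T j) x‖ ≤ C * ‖x.2‖ ^ (p - 1) := by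
  obtain ⟨hsm, C, hC⟩ := hK
  let b : ContDiffBump (0 : X) := ⟨1, 2, one_pos, one_lt_two⟩
  have hb : ContDiff ℝ ∞ (b : X → ℝ) := b.contDiff
  obtain ⟨M, hM⟩ : ∃ M, ∀ z, ‖fderiv ℝ (b : X → ℝ) z‖ ≤ M :=
    (hb.continuous_fderiv (by simp)).bounded_above_of_compact_support
      (b.hasCompactSupport.fderiv ℝ)
  have hM0 : 0 ≤ M := (norm_nonneg _).trans (hM 0)
  set a : ℕ → E × X → ℝ := fun j x => 1 - b (((j : ℝ) + 1) • x.2) with ha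
  have hasm : ∀ j, ContDiff ℝ ∞ (a j) := fun j =>
    contDiff_const.sub (hb.comp (contDiff_const.smul contDiff_snd))
  have ha01 : ∀ j x, |a j x| ≤ 1 := by
    intro j x
    have h1 := b.nonneg (x := ((j : ℝ) + 1) • x.2)
    have h2 := b.le_one (x := ((j : ℝ) + 1) • x.2)
    rw [abs_le]
    constructor <;> simp only [ha] <;> linarith
  have hC0 : ∀ x : E × X, x.2 ≠ 0 → 0 ≤ C := by
    intro x hx
    have := (abs_nonneg _).trans (hC x hx).1
    exact nonneg_of_mul_nonneg_left this (by positivity)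
  have hfar : ∀ j : ℕ, ∀ x : E × X, 2 / ((j : ℝ) + 1) < ‖x.2‖ →
      (fun x => a j x * K x) =ᶠ[𝓝 x] K := by
    intro j x hx
    have : {x : E × X | 2 / ((j : ℝ) + 1) < ‖x.2‖} ∈ 𝓝 x :=
      (isOpen_lt continuous_const (continuous_norm.comp continuous_snd)).mem_nhds hx
    filter_upwards [this] with y hy
    have hj : (0 : ℝ) < (j : ℝ) + 1 := by positivity
    have : b (((j : ℝ) + 1) • y.2) = 0 := by
      apply b.zero_of_le_dist
      rw [dist_zero_right, norm_smul, Real.norm_of_nonneg hj.le]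
      rw [div_lt_iff₀ hj] at hy
      change (2 : ℝ) ≤ _
      linarith
    simp [ha, this]
  refine ⟨|C| * (1 + 2 * M), by positivity, fun j x => a j x * K x, fun j => ⟨?_, ?_, hfar j, ?_⟩⟩
  · rw [contDiff_iff_contDiffAt]
    intro x
    by_cases hx : x.2 = 0
    · have hj : (0 : ℝ) < (j : ℝ) + 1 := by positivity
      have : {y : E × X | ‖((j : ℝ) + 1) • y.2‖ < 1} ∈ 𝓝 x :=
        (isOpen_lt (continuous_norm.comp (continuous_const.smul continuous_snd))
          continuous_const).mem_nhds (by simp [hx])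
      refine (contDiffAt_const (c := (0 : ℝ))).congr_of_eventuallyEq ?_
      filter_upwards [this] with y hy
      have : b (((j : ℝ) + 1) • y.2) = 1 := by
        apply b.one_of_mem_closedBall
        rw [mem_closedBall_zero_iff]
        exact le_of_lt hy
      simp [ha, this]
    · exact (hasm j).contDiffAt.mul (hsm.contDiffAt (isOpen_snd_ne_zero.mem_nhds hx))
  · intro x hx
    simp [hx]
  · intro x hx
    have hz : 0 < ‖x.2‖ := norm_pos_iff.mpr hx
    have hCC := hC0 x hx
    rw [abs_of_nonneg hCC]
    obtain ⟨h1, h2⟩ := hC x hx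
    have h3 : C * ‖x.2‖ ^ p ≤ C * (1 + 2 * M) * ‖x.2‖ ^ p := by
      gcongr
      nlinarith [mul_nonneg hCC hM0]
    have h4 : C * ‖x.2‖ ^ (p - 1) ≤ C * (1 + 2 * M) * ‖x.2‖ ^ (p - 1) := by
      gcongr
      nlinarith [mul_nonneg hCC hM0]
    constructor
    · rw [abs_mul]
      calc |a j x| * |K x| ≤ 1 * |K x| := by gcongr; exact ha01 j x
        _ ≤ _ := by rw [one_mul]; exact h1.trans h3
    · rcases lt_or_ge (2 / ((j : ℝ) + 1)) ‖x.2‖ with hlt | hge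
      · rw [(hfar j x hlt).fderiv_eq]
        exact h2.trans h4
      · have hj : (0 : ℝ) < (j : ℝ) + 1 := by positivity
        have hKd : DifferentiableAt ℝ K x :=
          (hsm.contDiffAt (isOpen_snd_ne_zero.mem_nhds hx)).differentiableAt (by simp)
        have had : HasFDerivAt (a j) (-((fderiv ℝ (b : X → ℝ) (((j : ℝ) + 1) • x.2)).comp
            (((j : ℝ) + 1) • ContinuousLinearMap.snd ℝ E X))) x := by
          have h5 : HasFDerivAt (b : X → ℝ) _ (((j : ℝ) + 1) • x.2) :=
            (hb.differentiable (by simp) _).hasFDerivAt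
          have h6 : HasFDerivAt (fun y : E × X => ((j : ℝ) + 1) • y.2)
            (((j : ℝ) + 1) • ContinuousLinearMap.snd ℝ E X) x := hasFDerivAt_snd.const_smul _
          exact (h5.comp x h6).const_sub 1
        change ‖fderiv ℝ (a j * K) x‖ ≤ _
        rw [(had.mul hKd.hasFDerivAt).fderiv]
        have h7 : ‖(-((fderiv ℝ (b : X → ℝ) (((j : ℝ) + 1) • x.2)).comp
            (((j : ℝ) + 1) • ContinuousLinearMap.snd ℝ E X)))‖ ≤ M * ((j : ℝ) + 1) := by
          rw [norm_neg]
          refine (ContinuousLinearMap.opNorm_comp_le _ _).trans ?_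
          gcongr
          · exact hM _
          · rw [norm_smul, Real.norm_of_nonneg hj.le]
            exact mul_le_of_le_one_right hj.le (ContinuousLinearMap.norm_snd_le _ _ _)
        have h8 : (j : ℝ) + 1 ≤ 2 * ‖x.2‖⁻¹ := by
          rw [le_div_iff₀ hj] at hge
          rw [← div_eq_mul_inv, le_div_iff₀ hz]
          linarith
        refine (norm_add_le _ _).trans ?_
        rw [norm_smul, norm_smul, Real.norm_eq_abs, Real.norm_eq_abs]
        calc |a j x| * ‖fderiv ℝ K x‖ + |K x| * _
            ≤ 1 * (C * ‖x.2‖ ^ (p - 1)) + (C * ‖x.2‖ ^ p) * (M * (2 * ‖x.2‖⁻¹)) := by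
              gcongr
              · exact ha01 j x
              · exact h7.trans (by gcongr)
          _ = C * (1 + 2 * M) * ‖x.2‖ ^ (p - 1) := by
              rw [Real.rpow_sub_one hz.ne']
              field_simp

end Kernels

/-! ### One derivative against a bounded density. -/

section Kernels

open Metric Filter Topology

variable {E X : Type*} [NormedAddCommGroup E] [NormedSpace ℝ E] [FiniteDimensional ℝ E]
  [NormedAddCommGroup X] [NormedSpace ℝ X] [FiniteDimensional ℝ X]
variable {𝕜 : Type*} [RCLike 𝕜]
variable [MeasurableSpace X] [BorelSpace X] {μ : Measure X} [μ.IsAddHaarMeasure]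

theorem fderiv_eq_zero_of_norm_snd_lt {K : E × X → ℝ} {R : ℝ}
    (hsupp : ∀ x : E × X, R < ‖x.2‖ → K x = 0) (x : E × X) (hx : R < ‖x.2‖) :
    fderiv ℝ K x = 0 := by
  have : {x : E × X | R < ‖x.2‖} ∈ 𝓝 x :=
    (isOpen_lt continuous_const (continuous_norm.comp continuous_snd)).mem_nhds hx
  have h : K =ᶠ[𝓝 x] fun _ => 0 := by
    filter_upwards [this] with y hy using hsupp y hy
  rw [h.fderiv_eq]
  exact fderiv_const_apply 0

theorem exists_bilin_bound {V W Y : Type*} [NormedAddCommGroup V] [NormedSpace ℝ V]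
    [NormedAddCommGroup W] [NormedSpace ℝ W] [NormedAddCommGroup Y] [NormedSpace ℝ Y]
    (B : V →L[ℝ] W →L[ℝ] Y) : ∃ b : ℝ, 0 ≤ b ∧ ∀ v w, ‖B v w‖ ≤ b * ‖v‖ * ‖w‖ :=
  ⟨‖B‖, B.opNorm_nonneg, B.le_opNorm₂⟩

/-- Only the supremum of `F` enters the bound; applied to the translates `z ↦ F (ι t - z)`, it is
therefore uniform in `t`. -/
theorem norm_integral_bilin_sub_le [Nontrivial X] {W Y : Type*} [NormedAddCommGroup W]
    [NormedSpace ℝ W] [NormedAddCommGroup Y] [NormedSpace ℝ Y]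
    (B : 𝕜 →L[ℝ] W →L[ℝ] Y) {F : X → 𝕜} {G H : X → W} {M C r p : ℝ}
    (hp : -(Module.finrank ℝ X : ℝ) < p) (hF : Measurable F) (hM : ∀ y, ‖F y‖ ≤ M)
    (hG : Integrable G μ) (hH : Integrable H μ)
    (hGH : ∀ z, r < ‖z‖ → G z = H z) (hb : ∀ z ≠ 0, ‖G z - H z‖ ≤ C * ‖z‖ ^ p)
    {b : ℝ} (hb0 : 0 ≤ b) (hB : ∀ v w, ‖B v w‖ ≤ b * ‖v‖ * ‖w‖) :
    ‖(∫ z, B (F z) (G z) ∂μ) - ∫ z, B (F z) (H z) ∂μ‖ ≤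
      b * M * C * ∫ z in closedBall (0 : X) r, ‖z‖ ^ p ∂μ := by
  have hM0 : 0 ≤ M := (norm_nonneg _).trans (hM 0)
  rw [← integral_sub (integrable_bilin_of_bounded B hF.aestronglyMeasurable hM hG)
    (integrable_bilin_of_bounded B hF.aestronglyMeasurable hM hH), ← integral_const_mul,
    ← integral_indicator measurableSet_closedBall]
  have hi : IntegrableOn (fun z : X => ‖z‖ ^ p) (closedBall 0 r) μ :=
    (integrableOn_norm_rpow_ball hp (r + 1)).mono_set (closedBall_subset_ball (by linarith))
  refine norm_integral_le_of_norm_le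
    ((integrable_indicator_iff measurableSet_closedBall).mpr (hi.const_mul _)) ?_
  have : ∀ᵐ z ∂μ, z ≠ 0 := by
    rw [ae_iff]
    simp
  filter_upwards [this] with z hz
  rw [← map_sub]
  by_cases hzr : ‖z‖ ≤ r
  · rw [indicator_of_mem (by simpa using hzr)]
    calc ‖B (F z) (G z - H z)‖ ≤ b * ‖F z‖ * ‖G z - H z‖ := hB _ _
      _ ≤ b * M * (C * ‖z‖ ^ p) := by
        gcongr
        · exact hM z
        · exact hb z hz
      _ = _ := by ring
  · rw [indicator_of_notMem (by simpa using hzr), hGH z (not_le.mp hzr)]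
    simp

/-- Truncated kernels give continuously differentiable integrals. Since the full derivative of `K`
has integrable order `p - 1`, their derivatives converge uniformly in `t` to the formal derivative,
and the integrals converge pointwise. -/
theorem contDiff_one_paramIntegral [Nontrivial X] (ι : E →L[ℝ] X) {K : E × X → ℝ} {F : X → 𝕜}
    {p R : ℝ} (hp : -(Module.finrank ℝ X : ℝ) < p - 1)
    (hK : IsSingularKernel {x : E × X | x.2 ≠ 0} p K)
    (hsupp : ∀ x : E × X, R < ‖x.2‖ → K x = 0)
    (hF : Measurable F ∧ ∃ C, ∀ y, ‖F y‖ ≤ C) :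
    ContDiff ℝ 1 (paramIntegral μ ι K F) := by
  obtain ⟨C₁, hC₁, T, hT⟩ := exists_truncation hK
  obtain ⟨hsm, C₀, hC₀⟩ := hK
  obtain ⟨hFm, M, hM⟩ := id hF
  have hM0 : 0 ≤ M := (norm_nonneg _).trans (hM 0)
  have hTs : ∀ j x, R < ‖x.2‖ → T j x = 0 := fun j x hx => (hT j).2.1 x (hsupp x hx)
  have hsl : ∀ t : E, ContinuousOn (fun z : X => (t, z)) {0}ᶜ := fun t => by fun_prop
  have hmaps : ∀ t : E, MapsTo (fun z : X => (t, z)) {0}ᶜ {x : E × X | x.2 ≠ 0} :=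
    fun t z hz => hz
  have hKi : ∀ t, Integrable (fun z => K (t, z)) μ := fun t =>
    integrable_of_norm_le_rpow (p := p) (C := C₀) (by linarith)
      (hsm.continuousOn.comp (hsl t) (hmaps t)) (fun z hz => hsupp (t, z) hz)
      fun z hz => (hC₀ (t, z) hz).1
  have hTi : ∀ j t, Integrable (fun z => T j (t, z)) μ := fun j t =>
    integrable_of_norm_le_rpow (p := p) (C := C₁) (by linarith)
      ((hT j).1.continuous.continuousOn.comp (hsl t) (mapsTo_univ _ _))
      (fun z hz => hTs j (t, z) hz) fun z hz => ((hT j).2.2.2 (t, z) hz).1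
  have hDKi : ∀ t, Integrable (fun z => fderiv ℝ K (t, z)) μ := fun t =>
    integrable_of_norm_le_rpow (p := p - 1) (C := C₀) hp
      ((hsm.continuousOn_fderiv_of_isOpen isOpen_snd_ne_zero (by simp)).comp (hsl t) (hmaps t))
      (fun z hz => fderiv_eq_zero_of_norm_snd_lt hsupp (t, z) hz) fun z hz => (hC₀ (t, z) hz).2
  have hDTi : ∀ j t, Integrable (fun z => fderiv ℝ (T j) (t, z)) μ := fun j t =>
    integrable_of_norm_le_rpow (p := p - 1) (C := C₁) hp
      (((hT j).1.continuous_fderiv (by simp)).continuousOn.comp (hsl t) (mapsTo_univ _ _))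
      (fun z hz => fderiv_eq_zero_of_norm_snd_lt (hTs j) (t, z) hz)
      fun z hz => ((hT j).2.2.2 (t, z) hz).2
  have hder := fun j => hasFDerivAt_paramIntegral_of_contDiff (μ := μ) ι (hT j).1 (hTs j) hF
  have hδ := tendsto_setIntegral_closedBall_rpow (μ := μ) hp
  have hFt : ∀ t, Measurable fun z => F (ι t - z) := fun t =>
    hFm.comp (measurable_const.sub measurable_id)
  set ρ := (ContinuousLinearMap.id ℝ E).prod ι
  set B := ((ContinuousLinearMap.lsmul ℝ ℝ : ℝ →L[ℝ] 𝕜 →L[ℝ] 𝕜).flip.precompR (E × X))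
  obtain ⟨b, hb0, hB⟩ := exists_bilin_bound B
  have hunif : TendstoUniformly (fun j => paramIntegralDeriv μ ι (T j) F)
      (paramIntegralDeriv μ ι K F) atTop := by
    rw [Metric.tendstoUniformly_iff]
    intro ε hε
    have h1 := hδ.const_mul (b * M * (C₁ + C₀) * ‖ρ‖)
    rw [mul_zero] at h1
    filter_upwards [h1.eventually_lt_const hε] with j hj t
    refine lt_of_le_of_lt ?_ hj
    rw [dist_comm, dist_eq_norm]
    simp only [paramIntegralDeriv]
    rw [← ContinuousLinearMap.sub_comp]
    refine (ContinuousLinearMap.opNorm_comp_le _ _).trans ?_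
    have h2 := norm_integral_bilin_sub_le (μ := μ) B (C := C₁ + C₀) (r := 2 / ((j : ℝ) + 1)) hp
      (hFt t) (fun y => hM _) (hDTi j t) (hDKi t)
      (fun z hz => ((hT j).2.2.1 (t, z) hz).fderiv_eq) (fun z hz => ?_) hb0 hB
    · calc _ ≤ _ * ‖ρ‖ := mul_le_mul_of_nonneg_right h2 (norm_nonneg _)
        _ = _ := by ring
    · refine (norm_sub_le _ _).trans ?_
      rw [add_mul]
      exact add_le_add ((hT j).2.2.2 (t, z) hz).2 (hC₀ (t, z) hz).2
  have hpt : ∀ t, Tendsto (fun j => paramIntegral μ ι (T j) F t) atTop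
      (𝓝 (paramIntegral μ ι K F t)) := by
    intro t
    rw [tendsto_iff_norm_sub_tendsto_zero]
    let B₀ := (ContinuousLinearMap.lsmul ℝ ℝ : ℝ →L[ℝ] 𝕜 →L[ℝ] 𝕜).flip
    obtain ⟨b₀, hb₀, hB₀⟩ := exists_bilin_bound B₀
    -- On the support `‖z‖ ^ p ≤ |R| * ‖z‖ ^ (p - 1)`, so the limit already obtained for the
    -- exponent `p - 1` serves here too.
    have h1 := hδ.const_mul (b₀ * M * ((|C₁| + |C₀|) * |R|))
    rw [mul_zero] at h1
    refine squeeze_zero (fun _ => norm_nonneg _) (fun j => ?_) h1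
    refine norm_integral_bilin_sub_le (μ := μ) B₀ (C := (|C₁| + |C₀|) * |R|)
      (r := 2 / ((j : ℝ) + 1)) hp (hFt t) (fun y => hM _) (hTi j t) (hKi t)
      (fun z hz => ((hT j).2.2.1 (t, z) hz).eq_of_nhds) (fun z hz => ?_) hb₀ hB₀
    have hz0 : 0 < ‖z‖ := norm_pos_iff.mpr hz
    rcases lt_or_ge R ‖z‖ with hR | hR
    · rw [hTs j (t, z) hR, hsupp (t, z) hR]
      simp only [sub_zero, norm_zero]
      positivity
    · refine (norm_sub_le _ _).trans ?_
      calc ‖T j (t, z)‖ + ‖K (t, z)‖ ≤ C₁ * ‖z‖ ^ p + C₀ * ‖z‖ ^ p :=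
            add_le_add ((hT j).2.2.2 (t, z) hz).1 (hC₀ (t, z) hz).1
        _ ≤ |C₁| * ‖z‖ ^ p + |C₀| * ‖z‖ ^ p := by
            gcongr <;> exact le_abs_self _
        _ = (|C₁| + |C₀|) * ‖z‖ * ‖z‖ ^ (p - 1) := by
            rw [Real.rpow_sub_one hz0.ne']
            field_simp
        _ ≤ _ := by
            gcongr
            exact hR.trans (le_abs_self R)
  have hlim := hasFDerivAt_of_tendstoUniformly hunif (fun j t => (hder j).1 t) hpt
  rw [contDiff_one_iff_fderiv]
  refine ⟨fun t => (hlim t).differentiableAt, ?_⟩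
  rw [show fderiv ℝ (paramIntegral μ ι K F) = paramIntegralDeriv μ ι K F from
    funext fun t => (hlim t).fderiv]
  exact hunif.continuous (Frequently.of_forall fun j => (hder j).2)

end Kernels

/-! ### Higher derivatives along the parameter. -/

section Kernels

open Metric Filter Topology

variable {E X : Type*} [NormedAddCommGroup E] [NormedSpace ℝ E] [FiniteDimensional ℝ E]
  [NormedAddCommGroup X] [NormedSpace ℝ X] [FiniteDimensional ℝ X]
variable {𝕜 : Type*} [RCLike 𝕜]

theorem IsParamKernel.of_succ {D : Set (E × X)} {p : ℝ} {k : ℕ} {K : E × X → ℝ}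
    (h : IsParamKernel D p (k + 1) K) : IsParamKernel D p k K := by
  induction k generalizing K with
  | zero => exact h.1
  | succ k ih => exact ⟨h.1, fun v => ih (h.2 v)⟩

variable [MeasurableSpace X] [BorelSpace X] {μ : Measure X} [μ.IsAddHaarMeasure]

theorem IsTangentiallyBounded.of_succ {ι : E →L[ℝ] X} {m : ℕ} {F : X → 𝕜}
    (h : IsTangentiallyBounded ι (m + 1) F) : IsTangentiallyBounded ι m F := by
  induction m generalizing F with
  | zero => exact h.1
  | succ m ih =>
    obtain ⟨h0, F', h1, h2, h3⟩ := h
    exact ⟨h0, F', h1, h2, fun v => ih (h3 v)⟩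

theorem aestronglyMeasurable_clm_of_apply {F' : X → E →L[ℝ] 𝕜}
    (h : ∀ v, Measurable fun y => F' y v) : AEStronglyMeasurable F' μ := by
  let b := Module.finBasis ℝ E
  have hF : F' = fun y => ∑ i, ContinuousLinearMap.smulRightL ℝ E 𝕜
      (LinearMap.toContinuousLinearMap (b.coord i)) (F' y (b i)) := by
    ext y v
    conv_lhs => rw [← b.sum_repr v, map_sum]
    simp
  rw [hF]
  refine Finset.aestronglyMeasurable_fun_sum _ fun i _ => ?_
  exact (ContinuousLinearMap.continuous _).comp_aestronglyMeasurable
    (h (b i)).aestronglyMeasurable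

/-- `IsParamKernel` gives bounds direction by direction; a finite basis turns them into an operator
norm bound. -/
theorem exists_norm_clm_le_rpow {p : ℝ} {D : E × X → E →L[ℝ] ℝ}
    (h : ∀ v, ∃ C, ∀ x : E × X, x.2 ≠ 0 → |D x v| ≤ C * ‖x.2‖ ^ p) :
    ∃ C, ∀ x : E × X, x.2 ≠ 0 → ‖D x‖ ≤ C * ‖x.2‖ ^ p := by
  let b := Module.finBasis ℝ E
  obtain ⟨c, hc, hb⟩ := b.exists_opNorm_le (F := ℝ)
  choose C hC using h
  refine ⟨c * ∑ i, |C (b i)|, fun x hx => ?_⟩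
  rw [mul_assoc]
  refine hb (by positivity) fun i => (hC (b i) x hx).trans ?_
  gcongr
  exact (le_abs_self _).trans
    (Finset.single_le_sum (f := fun i => |C (b i)|) (fun i _ => abs_nonneg _) (Finset.mem_univ i))

/-- Differentiating under the integral at fixed `z` yields two integrals of the same kind, one with
a tangential derivative of `F` and one with a `t`-derivative of `K`, with the order `p` unchanged.
Induction therefore ends at the `C¹` case, which supplies the extra derivative. -/
theorem contDiff_paramIntegral [Nontrivial X] (ι : E →L[ℝ] X) {p R : ℝ}
    (hp : -(Module.finrank ℝ X : ℝ) < p - 1) (m : ℕ) {K : E × X → ℝ} {F : X → 𝕜}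
    (hK : IsParamKernel {x : E × X | x.2 ≠ 0} p m K)
    (hsupp : ∀ x : E × X, R < ‖x.2‖ → K x = 0)
    (hF : IsTangentiallyBounded ι m F) :
    ContDiff ℝ (m + 1) (paramIntegral μ ι K F) := by
  induction m generalizing K F with
  | zero =>
    simpa using contDiff_one_paramIntegral ι hp hK hsupp hF.bounded
  | succ m ih =>
    have hK0 := hK.of_succ
    have hF0 := hF.of_succ
    obtain ⟨⟨hsm, C₀, hC₀⟩, hKv⟩ := hK
    obtain ⟨⟨hFm, M, hM⟩, F', hF', ⟨M', hM'⟩, hFv⟩ := hF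
    have hDsupp := fderiv_eq_zero_of_norm_snd_lt hsupp
    set DK : E × X → E →L[ℝ] ℝ := fun x => (fderiv ℝ K x).comp (ContinuousLinearMap.inl ℝ E X)
    obtain ⟨C₁, hC₁⟩ := exists_norm_clm_le_rpow (p := p) (D := DK) fun v => by
      obtain ⟨-, C, hC⟩ := (hKv v).isSingularKernel
      exact ⟨C, fun x hx => (hC x hx).1⟩
    have hsl : ∀ t : E, ContinuousOn (fun z : X => (t, z)) {0}ᶜ := fun t => by fun_prop
    have hmaps : ∀ t : E, MapsTo (fun z : X => (t, z)) {0}ᶜ {x : E × X | x.2 ≠ 0} :=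
      fun t z hz => hz
    have hDKsm : ContinuousOn DK {x : E × X | x.2 ≠ 0} :=
      (hsm.continuousOn_fderiv_of_isOpen isOpen_snd_ne_zero (by simp)).clm_comp continuousOn_const
    have hKi : ∀ t, Integrable (fun z => K (t, z)) μ := fun t =>
      integrable_of_norm_le_rpow (p := p) (C := C₀) (by linarith)
        (hsm.continuousOn.comp (hsl t) (hmaps t)) (fun z hz => hsupp (t, z) hz)
        fun z hz => (hC₀ (t, z) hz).1
    have hDKi : ∀ t, Integrable (fun z => DK (t, z)) μ := fun t =>
      integrable_of_norm_le_rpow (p := p) (C := C₁) (R := R) (by linarith)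
        (hDKsm.comp (hsl t) (hmaps t))
        (fun z hz => by
          change (fderiv ℝ K (t, z)).comp _ = 0
          rw [hDsupp (t, z) hz, ContinuousLinearMap.zero_comp])
        fun z hz => hC₁ (t, z) hz
    have hFt : ∀ t, Measurable fun z => F (ι t - z) := fun t =>
      hFm.comp (measurable_const.sub measurable_id)
    have hF't : ∀ t v, Measurable fun z => F' (ι t - z) v := fun t v =>
      (hFv v).bounded.1.comp (measurable_const.sub measurable_id)
    have hF'm : ∀ t, AEStronglyMeasurable (fun z => F' (ι t - z)) μ := fun t =>
      aestronglyMeasurable_clm_of_apply (hF't t)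
    have hi₁ : ∀ t, Integrable (fun z => K (t, z) • F' (ι t - z)) μ := fun t =>
      (hKi t).smul_bdd M' (hF'm t) (Eventually.of_forall fun z => hM' _)
    have hi₂ : ∀ t, Integrable (fun z => (DK (t, z)).smulRight (F (ι t - z))) μ := fun t =>
      integrable_bilin_of_bounded (ContinuousLinearMap.smulRightL ℝ E 𝕜).flip
        (hFt t).aestronglyMeasurable (fun z => hM _) (hDKi t)
    have hae : ∀ᵐ z ∂μ, z ≠ 0 := by
      rw [ae_iff]
      simp
    have hder : ∀ t₀, HasFDerivAt (paramIntegral μ ι K F)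
        (∫ z, K (t₀, z) • F' (ι t₀ - z) + (DK (t₀, z)).smulRight (F (ι t₀ - z)) ∂μ) t₀ := by
      intro t₀
      refine hasFDerivAt_integral_of_dominated_of_fderiv_le (s := univ)
        (F' := fun t z => K (t, z) • F' (ι t - z) + (DK (t, z)).smulRight (F (ι t - z)))
        (bound := (ball (0 : X) (R + 1)).indicator fun z => (|C₀| * M' + |C₁| * M) * ‖z‖ ^ p)
        univ_mem (Eventually.of_forall fun t => ?_) ?_ ?_ ?_ ?_ ?_
      · exact (hKi t).1.smul (hFt t).aestronglyMeasurable
      · exact (hKi t₀).smul_bdd M (hFt t₀).aestronglyMeasurable (Eventually.of_forall fun z => hM _)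
      · exact (hi₁ t₀).1.add (hi₂ t₀).1
      · filter_upwards [hae] with z hz t _
        have hM0 : 0 ≤ M := (norm_nonneg _).trans (hM 0)
        have hM'0 : 0 ≤ M' := (norm_nonneg _).trans (hM' 0)
        by_cases hzR : ‖z‖ < R + 1
        · rw [indicator_of_mem (by simpa using hzR)]
          refine (norm_add_le _ _).trans ?_
          rw [norm_smul, ContinuousLinearMap.norm_smulRight_apply, add_mul, mul_right_comm,
            mul_right_comm |C₁|]
          gcongr
          · refine ((hC₀ (t, z) hz).1).trans ?_
            gcongr
            exact le_abs_self _
          · exact hM' _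
          · refine (hC₁ (t, z) hz).trans ?_
            gcongr
            exact le_abs_self _
          · exact hM _
        · have hR : R < ‖(t, z).2‖ := by
            change R < ‖z‖
            linarith
          rw [indicator_of_notMem (by simpa using hzR), hsupp _ hR,
            show DK (t, z) = 0 by
              change (fderiv ℝ K (t, z)).comp _ = 0
              rw [hDsupp (t, z) hR, ContinuousLinearMap.zero_comp]]
          simp
      · rw [integrable_indicator_iff measurableSet_ball]
        exact (integrableOn_norm_rpow_ball (by linarith) _).const_mul _
      · filter_upwards [hae] with z hz t _
        have h1 : HasFDerivAt (fun t => K (t, z)) (DK (t, z)) t := by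
          have h2 : HasFDerivAt K (fderiv ℝ K (t, z)) (t, z) :=
            ((hsm.contDiffAt (isOpen_snd_ne_zero.mem_nhds hz)).differentiableAt
              (by simp)).hasFDerivAt
          exact h2.comp t (hasFDerivAt_prodMk_left t z)
        have h3 : HasFDerivAt (fun t => F (ι t - z)) (F' (ι t - z)) t := by
          -- The base point `0` is written `t - t` to match the chain rule with `s ↦ s - t`.
          have h4 : HasFDerivAt (fun s => F (ι t - z + ι s)) (F' (ι t - z)) (t - t) := by
            rw [sub_self]
            exact hF' _
          have h5 := HasFDerivAt.comp (f := fun s => s - t) (g := fun s => F (ι t - z + ι s)) t h4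
            ((hasFDerivAt_id t).sub_const t)
          rw [ContinuousLinearMap.comp_id] at h5
          have h6 : (fun s => F (ι s - z)) =
              (fun s => F (ι t - z + ι s)) ∘ fun s => s - t := by
            ext s
            simp only [Function.comp, map_sub]
            congr 1
            abel
          rw [h6]
          exact h5
        exact h1.smul h3
    have hdir : ∀ t v, fderiv ℝ (paramIntegral μ ι K F) t v =
        paramIntegral μ ι K (fun y => F' y v) t +
          paramIntegral μ ι (fun x => fderiv ℝ K x (v, 0)) F t := by
      intro t v
      rw [(hder t).fderiv, integral_add (hi₁ t) (hi₂ t), add_apply,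
        ContinuousLinearMap.integral_apply (hi₁ t), ContinuousLinearMap.integral_apply (hi₂ t)]
      rfl
    push_cast
    rw [contDiff_succ_iff_fderiv]
    refine ⟨fun t => (hder t).differentiableAt, by simp, ?_⟩
    rw [contDiff_clm_apply_iff]
    intro v
    simp_rw [hdir]
    exact (ih hK0 hsupp (hFv v)).add
      (ih (hKv v) (fun x hx => by rw [hDsupp x hx]; rfl) hF0)

end Kernels

/-! ### Algebra of singular kernels. -/

section KernelCalculus

open Metric Filter Topology

variable {E X : Type*} [NormedAddCommGroup E] [NormedSpace ℝ E] [FiniteDimensional ℝ E]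
  [NormedAddCommGroup X] [NormedSpace ℝ X] [FiniteDimensional ℝ X]
  {D : Set (E × X)} {p q : ℝ} {k : ℕ} {K L : E × X → ℝ}

theorem IsSingularKernel.exists_nonneg_bound (hK : IsSingularKernel D p K) :
    ∃ C, 0 ≤ C ∧ ∀ x ∈ D, |K x| ≤ C * ‖x.2‖ ^ p ∧ ‖fderiv ℝ K x‖ ≤ C * ‖x.2‖ ^ (p - 1) := by
  obtain ⟨-, C, hC⟩ := hK
  refine ⟨|C|, abs_nonneg C, fun x hx => ⟨(hC x hx).1.trans ?_, (hC x hx).2.trans ?_⟩⟩ <;>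
  · gcongr
    exact le_abs_self C

theorem IsSingularKernel.congr (hD : IsOpen D) (hK : IsSingularKernel D p K) (h : EqOn L K D) :
    IsSingularKernel D p L := by
  obtain ⟨hs, C, hC⟩ := hK
  refine ⟨hs.congr h, C, fun x hx => ?_⟩
  rw [h hx, (h.eventuallyEq_of_mem (hD.mem_nhds hx)).fderiv_eq]
  exact hC x hx

theorem IsParamKernel.congr (hD : IsOpen D) (hK : IsParamKernel D p k K) (h : EqOn L K D) :
    IsParamKernel D p k L := by
  induction k generalizing K L with
  | zero => exact IsSingularKernel.congr hD hK h
  | succ k ih =>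
    refine ⟨hK.1.congr hD h, fun v => ih (hK.2 v) fun x hx => ?_⟩
    simp only [(h.eventuallyEq_of_mem (hD.mem_nhds hx)).fderiv_eq]

theorem IsSingularKernel.differentiableAt (hD : IsOpen D) (hK : IsSingularKernel D p K)
    {x : E × X} (hx : x ∈ D) : DifferentiableAt ℝ K x :=
  (hK.1.contDiffAt (hD.mem_nhds hx)).differentiableAt (by simp)

theorem IsSingularKernel.add (hD : IsOpen D) (hK : IsSingularKernel D p K)
    (hL : IsSingularKernel D p L) : IsSingularKernel D p (K + L) := by
  obtain ⟨C, -, hC⟩ := hK.exists_nonneg_bound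
  obtain ⟨C', -, hC'⟩ := hL.exists_nonneg_bound
  refine ⟨hK.1.add hL.1, C + C', fun x hx => ⟨?_, ?_⟩⟩
  · rw [add_mul]
    exact (abs_add_le _ _).trans (add_le_add (hC x hx).1 (hC' x hx).1)
  · rw [add_mul, fderiv_add (hK.differentiableAt hD hx) (hL.differentiableAt hD hx)]
    exact (norm_add_le _ _).trans (add_le_add (hC x hx).2 (hC' x hx).2)

theorem IsParamKernel.add (hD : IsOpen D) (hK : IsParamKernel D p k K)
    (hL : IsParamKernel D p k L) : IsParamKernel D p k (K + L) := by
  induction k generalizing K L with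
  | zero => exact IsSingularKernel.add hD hK hL
  | succ k ih =>
    refine ⟨hK.1.add hD hL.1, fun v => (ih (hK.2 v) (hL.2 v)).congr hD fun x hx => ?_⟩
    simp only [Pi.add_apply,
      fderiv_add (hK.1.differentiableAt hD hx) (hL.1.differentiableAt hD hx)]
    rfl

theorem IsSingularKernel.mul (hD : IsOpen D) (h0 : ∀ x ∈ D, x.2 ≠ 0)
    (hK : IsSingularKernel D p K) (hL : IsSingularKernel D q L) :
    IsSingularKernel D (p + q) (K * L) := by
  obtain ⟨C, hC0, hC⟩ := hK.exists_nonneg_bound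
  obtain ⟨C', hC'0, hC'⟩ := hL.exists_nonneg_bound
  refine ⟨hK.1.mul hL.1, 2 * (C * C'), fun x hx => ?_⟩
  have hz : 0 < ‖x.2‖ := norm_pos_iff.mpr (h0 x hx)
  obtain ⟨h1, h2⟩ := hC x hx
  obtain ⟨h3, h4⟩ := hC' x hx
  constructor
  · rw [Pi.mul_apply, abs_mul, Real.rpow_add hz]
    calc |K x| * |L x| ≤ (C * ‖x.2‖ ^ p) * (C' * ‖x.2‖ ^ q) := by gcongr
      _ = (C * C') * (‖x.2‖ ^ p * ‖x.2‖ ^ q) := by ring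
      _ ≤ 2 * (C * C') * (‖x.2‖ ^ p * ‖x.2‖ ^ q) := by
        refine mul_le_mul_of_nonneg_right ?_ (by positivity)
        nlinarith [mul_nonneg hC0 hC'0]
  · rw [fderiv_mul (hK.differentiableAt hD hx) (hL.differentiableAt hD hx)]
    refine (norm_add_le _ _).trans ?_
    rw [norm_smul, norm_smul]
    calc ‖K x‖ * ‖fderiv ℝ L x‖ + ‖L x‖ * ‖fderiv ℝ K x‖
        ≤ (C * ‖x.2‖ ^ p) * (C' * ‖x.2‖ ^ (q - 1)) +
          (C' * ‖x.2‖ ^ q) * (C * ‖x.2‖ ^ (p - 1)) := by gcongr <;> assumption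
      _ = 2 * (C * C') * ‖x.2‖ ^ (p + q - 1) := by
        rw [Real.rpow_sub_one hz.ne', Real.rpow_sub_one hz.ne', Real.rpow_sub_one hz.ne',
          Real.rpow_add hz]
        ring

theorem IsParamKernel.mul (hD : IsOpen D) (h0 : ∀ x ∈ D, x.2 ≠ 0)
    (hK : IsParamKernel D p k K) (hL : IsParamKernel D q k L) :
    IsParamKernel D (p + q) k (K * L) := by
  induction k generalizing K L with
  | zero => exact IsSingularKernel.mul hD h0 hK hL
  | succ k ih =>
    refine ⟨hK.1.mul hD h0 hL.1, fun v => ((ih hK.of_succ (hL.2 v)).add hD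
      (ih (hK.2 v) hL.of_succ)).congr hD fun x hx => ?_⟩
    simp only [Pi.add_apply, Pi.mul_apply,
      fderiv_mul (hK.1.differentiableAt hD hx) (hL.1.differentiableAt hD hx)]
    change K x * fderiv ℝ L x (v, 0) + L x * fderiv ℝ K x (v, 0) = _
    ring

theorem IsSingularKernel.mono_order (h0 : ∀ x ∈ D, x.2 ≠ 0) (h1 : ∀ x ∈ D, ‖x.2‖ ≤ 1)
    (hqp : q ≤ p) (hK : IsSingularKernel D p K) : IsSingularKernel D q K := by
  obtain ⟨C, hC0, hC⟩ := hK.exists_nonneg_bound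
  refine ⟨hK.1, C, fun x hx => ⟨(hC x hx).1.trans ?_, (hC x hx).2.trans ?_⟩⟩ <;>
  · have hz : 0 < ‖x.2‖ := norm_pos_iff.mpr (h0 x hx)
    refine mul_le_mul_of_nonneg_left ?_ hC0
    exact Real.rpow_le_rpow_of_exponent_ge hz (h1 x hx) (by linarith)

theorem IsParamKernel.mono_order (h0 : ∀ x ∈ D, x.2 ≠ 0) (h1 : ∀ x ∈ D, ‖x.2‖ ≤ 1)
    (hqp : q ≤ p) (hK : IsParamKernel D p k K) : IsParamKernel D q k K := by
  induction k generalizing K with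
  | zero => exact IsSingularKernel.mono_order h0 h1 hqp hK
  | succ k ih => exact ⟨hK.1.mono_order h0 h1 hqp, fun v => ih (hK.2 v)⟩

theorem IsParamKernel.const (c : ℝ) : IsParamKernel D 0 k fun _ => c := by
  induction k generalizing c with
  | zero =>
    refine ⟨contDiffOn_const, |c|, fun x _ => ⟨by simp, ?_⟩⟩
    rw [fderiv_fun_const]
    simp only [Pi.zero_apply, norm_zero]
    positivity
  | succ k ih =>
    refine ⟨IsParamKernel.isSingularKernel (ih c), fun v => ?_⟩
    simpa using ih 0

theorem IsParamKernel.const_mul (hD : IsOpen D) (h0 : ∀ x ∈ D, x.2 ≠ 0) (c : ℝ)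
    (hK : IsParamKernel D p k K) : IsParamKernel D p k fun x => c * K x := by
  have := (IsParamKernel.const c (D := D) (k := k)).mul hD h0 hK
  rwa [zero_add] at this

theorem IsParamKernel.zero : IsParamKernel D p k fun _ => 0 := by
  induction k with
  | zero => exact ⟨contDiffOn_const, 0, fun x _ => by simp⟩
  | succ k ih => exact ⟨ih.isSingularKernel, fun v => by simpa using ih⟩

theorem IsParamKernel.sum {I : Type*} (s : Finset I) (hD : IsOpen D)
    {K : I → E × X → ℝ} (hK : ∀ i, IsParamKernel D p k (K i)) :
    IsParamKernel D p k fun x => ∑ i ∈ s, K i x := by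
  classical
  induction s using Finset.induction_on with
  | empty => simpa using IsParamKernel.zero
  | insert i s hi ih =>
    simp only [Finset.sum_insert hi]
    exact (hK i).add hD ih

/-- The derivative is bounded, hence of order `-1` because `‖z‖ ≤ 1` on `D`. This allows
multiplication by a cutoff in both variables. -/
theorem IsParamKernel.of_contDiff_of_hasCompactSupport (h0 : ∀ x ∈ D, x.2 ≠ 0)
    (h1 : ∀ x ∈ D, ‖x.2‖ ≤ 1) (hK : ContDiff ℝ ∞ K) (hc : HasCompactSupport K) :
    IsParamKernel D 0 k K := by
  have hS : ∀ K : E × X → ℝ, ContDiff ℝ ∞ K → HasCompactSupport K → IsSingularKernel D 0 K := by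
    intro K hK hc
    obtain ⟨C, hC⟩ := hK.continuous.bounded_above_of_compact_support hc
    obtain ⟨C', hC'⟩ :=
      (hK.continuous_fderiv (by simp)).bounded_above_of_compact_support (hc.fderiv ℝ)
    refine ⟨hK.contDiffOn, max C C', fun x hx => ⟨?_, ?_⟩⟩
    · rw [Real.rpow_zero, mul_one]
      exact (hC x).trans (le_max_left _ _)
    · have hz : 0 < ‖x.2‖ := norm_pos_iff.mpr (h0 x hx)
      have hn : 0 ≤ max C C' := (norm_nonneg _).trans ((hC x).trans (le_max_left _ _))
      refine ((hC' x).trans (le_max_right _ _)).trans (le_mul_of_one_le_right hn ?_)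
      exact Real.one_le_rpow_of_pos_of_le_one_of_nonpos hz (h1 x hx) (by norm_num)
  induction k generalizing K with
  | zero => exact hS K hK hc
  | succ k ih =>
    refine ⟨hS K hK hc, fun v => ih ?_ (hc.fderiv_apply ℝ _)⟩
    exact (hK.fderiv_right (m := ∞) (by simp)).clm_apply contDiff_const

theorem IsParamKernel.extend_zero {U A : Set (E × X)} (hD : IsOpen D) (hU : IsOpen U)
    (hA : IsClosed A) (hAU : A ⊆ U) (hK : IsParamKernel (D ∩ U) p k K)
    (hKA : ∀ x, x ∉ A → K x = 0) : IsParamKernel D p k K := by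
  have hz : ∀ (K : E × X → ℝ), (∀ x, x ∉ A → K x = 0) → ∀ x, x ∉ A → K =ᶠ[𝓝 x] fun _ => 0 := by
    intro K hKA x hx
    filter_upwards [hA.isOpen_compl.mem_nhds hx] with y hy using hKA y hy
  have hS : ∀ K : E × X → ℝ, IsSingularKernel (D ∩ U) p K → (∀ x, x ∉ A → K x = 0) →
      IsSingularKernel D p K := by
    intro K hK hKA
    obtain ⟨C, hC0, hC⟩ := hK.exists_nonneg_bound
    refine ⟨fun x hx => ?_, C, fun x hx => ?_⟩
    · by_cases hxA : x ∈ A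
      · exact (hK.1.contDiffAt ((hD.inter hU).mem_nhds ⟨hx, hAU hxA⟩)).contDiffWithinAt
      · exact (contDiffAt_const.congr_of_eventuallyEq (hz K hKA x hxA)).contDiffWithinAt
    · by_cases hxA : x ∈ A
      · exact hC x ⟨hx, hAU hxA⟩
      · rw [hKA x hxA, (hz K hKA x hxA).fderiv_eq, fderiv_fun_const]
        simp only [abs_zero, Pi.zero_apply, norm_zero]
        constructor <;> positivity
  induction k generalizing K with
  | zero => exact hS K hK hKA
  | succ k ih =>
    refine ⟨hS K hK.1 hKA, fun v => ih (hK.2 v) fun x hx => ?_⟩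
    rw [(hz K hKA x hx).fderiv_eq, fderiv_fun_const]
    rfl

end KernelCalculus

/-! ### Differences, powers and logarithms as kernels. -/

section KernelCalculus

open Metric Filter Topology

variable {E X : Type*} [NormedAddCommGroup E] [NormedSpace ℝ E] [FiniteDimensional ℝ E]
  [NormedAddCommGroup X] [NormedSpace ℝ X] [FiniteDimensional ℝ X]
  {D : Set (E × X)} {p : ℝ} {k : ℕ} {q : E × X → ℝ}

/-- The order is one by the mean value inequality on a ball. The derivative along `(v, 0)` is again
such a difference, with `ψ` replaced by its derivative along `ι v`, so the order never drops. -/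
theorem IsParamKernel.difference (ι : E →L[ℝ] X) {ψ : X → ℝ} {T : Set X} (hT : IsOpen T)
    {x₀ : X} {ρ : ℝ} (hρ : closedBall x₀ ρ ⊆ T) (hψ : ContDiffOn ℝ ∞ ψ T)
    (hD : IsOpen D) (hD1 : ∀ x ∈ D, ι x.1 ∈ closedBall x₀ ρ)
    (hD2 : ∀ x ∈ D, ι x.1 - x.2 ∈ closedBall x₀ ρ) :
    IsParamKernel D 1 k fun x => ψ (ι x.1) - ψ (ι x.1 - x.2) := by
  set A : E × X →L[ℝ] X := ι.comp (ContinuousLinearMap.fst ℝ E X) with hA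
  set B : E × X →L[ℝ] X := A - ContinuousLinearMap.snd ℝ E X with hB
  have hAx : ∀ x : E × X, A x = ι x.1 := fun x => rfl
  have hBx : ∀ x : E × X, B x = ι x.1 - x.2 := fun x => rfl
  have hd : ∀ ψ : X → ℝ, ContDiffOn ℝ ∞ ψ T → ∀ x ∈ D,
      HasFDerivAt (fun x : E × X => ψ (ι x.1) - ψ (ι x.1 - x.2))
        ((fderiv ℝ ψ (ι x.1)).comp A - (fderiv ℝ ψ (ι x.1 - x.2)).comp B) x := by
    intro ψ hψ x hx
    have h1 : ∀ y ∈ closedBall x₀ ρ, HasFDerivAt ψ (fderiv ℝ ψ y) y := fun y hy =>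
      ((hψ.contDiffAt (hT.mem_nhds (hρ hy))).differentiableAt (by simp)).hasFDerivAt
    exact ((h1 (A x) (hD1 x hx)).comp x A.hasFDerivAt).sub
      ((h1 (B x) (hD2 x hx)).comp x B.hasFDerivAt)
  have hS : ∀ ψ : X → ℝ, ContDiffOn ℝ ∞ ψ T →
      IsSingularKernel D 1 fun x => ψ (ι x.1) - ψ (ι x.1 - x.2) := by
    intro ψ hψ
    have hcont : ContinuousOn (fderiv ℝ ψ) (closedBall x₀ ρ) :=
      (hψ.continuousOn_fderiv_of_isOpen hT (by simp)).mono hρ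
    obtain ⟨M, hM⟩ := (isCompact_closedBall x₀ ρ).exists_bound_of_continuousOn hcont
    refine ⟨?_, max M (M * ‖A‖ + M * ‖B‖), fun x hx => ⟨?_, ?_⟩⟩
    · exact (hψ.comp A.contDiff.contDiffOn fun x hx => hρ (hD1 x hx)).sub
        (hψ.comp B.contDiff.contDiffOn fun x hx => hρ (hD2 x hx))
    · rw [Real.rpow_one]
      have h := (convex_closedBall x₀ ρ).norm_image_sub_le_of_norm_fderiv_le (f := ψ) (C := M)
        (fun y hy => (hψ.contDiffAt (hT.mem_nhds (hρ hy))).differentiableAt (by simp))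
        hM (hD2 x hx) (hD1 x hx)
      rw [sub_sub_cancel] at h
      refine h.trans ?_
      gcongr
      exact le_max_left _ _
    · rw [sub_self, Real.rpow_zero, mul_one, (hd ψ hψ x hx).fderiv]
      refine le_trans ((norm_sub_le _ _).trans ?_) (le_max_right _ _)
      refine add_le_add ((ContinuousLinearMap.opNorm_comp_le _ _).trans ?_)
        ((ContinuousLinearMap.opNorm_comp_le _ _).trans ?_)
      · gcongr
        exact hM _ (hD1 x hx)
      · gcongr
        exact hM _ (hD2 x hx)
  induction k generalizing ψ with
  | zero => exact hS ψ hψ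
  | succ k ih =>
    refine ⟨hS ψ hψ, fun v => (ih (ψ := fun y => fderiv ℝ ψ y (ι v)) ?_).congr hD fun x hx => ?_⟩
    · exact (hψ.fderiv_of_isOpen hT (m := ∞) (by simp)).clm_apply contDiffOn_const
    · simp only [(hd ψ hψ x hx).fderiv]
      simp [hA, hB]

theorem IsSingularKernel.rpow (hD : IsOpen D) (h0 : ∀ x ∈ D, x.2 ≠ 0)
    (hq : IsSingularKernel D 2 q) {c : ℝ} (hc : 0 < c) (hlow : ∀ x ∈ D, c * ‖x.2‖ ^ (2 : ℝ) ≤ q x)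
    (s : ℝ) : IsSingularKernel D (2 * s) fun x => q x ^ s := by
  have hpos : ∀ x ∈ D, 0 < q x := fun x hx =>
    lt_of_lt_of_le (mul_pos hc (Real.rpow_pos_of_pos (norm_pos_iff.mpr (h0 x hx)) _)) (hlow x hx)
  obtain ⟨C, hC0, hC⟩ := hq.exists_nonneg_bound
  have hb : ∀ s : ℝ, ∃ M, 0 ≤ M ∧ ∀ x ∈ D, |q x ^ s| ≤ M * ‖x.2‖ ^ (2 * s) := by
    intro s
    refine ⟨C ^ s + c ^ s, by positivity, fun x hx => ?_⟩
    have hz : 0 < ‖x.2‖ := norm_pos_iff.mpr (h0 x hx)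
    rw [abs_of_pos (Real.rpow_pos_of_pos (hpos x hx) s), Real.rpow_mul hz.le]
    rcases le_total 0 s with hs | hs
    · calc q x ^ s ≤ (C * ‖x.2‖ ^ (2 : ℝ)) ^ s :=
            Real.rpow_le_rpow (hpos x hx).le ((le_abs_self _).trans (hC x hx).1) hs
        _ = C ^ s * (‖x.2‖ ^ (2 : ℝ)) ^ s := Real.mul_rpow hC0 (by positivity)
        _ ≤ _ := by
          gcongr
          exact le_add_of_nonneg_right (by positivity)
    · calc q x ^ s ≤ (c * ‖x.2‖ ^ (2 : ℝ)) ^ s :=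
            Real.rpow_le_rpow_of_nonpos (by positivity) (hlow x hx) hs
        _ = c ^ s * (‖x.2‖ ^ (2 : ℝ)) ^ s := Real.mul_rpow hc.le (by positivity)
        _ ≤ _ := by
          gcongr
          exact le_add_of_nonneg_left (by positivity)
  obtain ⟨M, hM0, hM⟩ := hb s
  obtain ⟨M', hM'0, hM'⟩ := hb (s - 1)
  refine ⟨hq.1.rpow_const_of_ne fun x hx => (hpos x hx).ne', max M (|s| * M' * C),
    fun x hx => ⟨?_, ?_⟩⟩
  · refine (hM x hx).trans ?_
    gcongr
    exact le_max_left _ _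
  · have hz : 0 < ‖x.2‖ := norm_pos_iff.mpr (h0 x hx)
    rw [((hq.differentiableAt hD hx).hasFDerivAt.rpow_const (Or.inl (hpos x hx).ne')).fderiv,
      norm_smul, norm_mul, Real.norm_eq_abs, Real.norm_eq_abs]
    calc |s| * |q x ^ (s - 1)| * ‖fderiv ℝ q x‖
        ≤ |s| * (M' * ‖x.2‖ ^ (2 * (s - 1))) * (C * ‖x.2‖ ^ ((2 : ℝ) - 1)) := by
          gcongr
          · exact hM' x hx
          · exact (hC x hx).2
      _ = |s| * M' * C * (‖x.2‖ ^ (2 * (s - 1)) * ‖x.2‖ ^ ((2 : ℝ) - 1)) := by ring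
      _ = |s| * M' * C * ‖x.2‖ ^ (2 * s - 1) := by
          rw [← Real.rpow_add hz]
          ring_nf
      _ ≤ _ := by
          gcongr
          exact le_max_right _ _

theorem IsParamKernel.rpow (hD : IsOpen D) (h0 : ∀ x ∈ D, x.2 ≠ 0)
    (hq : IsParamKernel D 2 k q) {c : ℝ} (hc : 0 < c) (hlow : ∀ x ∈ D, c * ‖x.2‖ ^ (2 : ℝ) ≤ q x)
    (s : ℝ) : IsParamKernel D (2 * s) k fun x => q x ^ s := by
  induction k generalizing s with
  | zero => exact IsSingularKernel.rpow hD h0 hq hc hlow s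
  | succ k ih =>
    refine ⟨hq.1.rpow hD h0 hc hlow s, fun v => ?_⟩
    have h := ((ih hq.of_succ (s - 1)).const_mul hD h0 s).mul hD h0 (hq.2 v)
    rw [show 2 * (s - 1) + 2 = 2 * s by ring] at h
    refine h.congr hD fun x hx => ?_
    have hpos : 0 < q x :=
      lt_of_lt_of_le (mul_pos hc (Real.rpow_pos_of_pos (norm_pos_iff.mpr (h0 x hx)) _)) (hlow x hx)
    simp only [((hq.1.differentiableAt hD hx).hasFDerivAt.rpow_const (Or.inl hpos.ne')).fderiv]
    rfl

/-- A logarithm is dominated by any negative power. The order `-1 / 2` is a convenient choice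
greater than `-1`, which in dimension two leaves room for one more derivative. -/
theorem IsSingularKernel.log (hD : IsOpen D) (h0 : ∀ x ∈ D, x.2 ≠ 0) (h1 : ∀ x ∈ D, ‖x.2‖ ≤ 1)
    (hq : IsSingularKernel D 2 q) {c : ℝ} (hc : 0 < c)
    (hlow : ∀ x ∈ D, c * ‖x.2‖ ^ (2 : ℝ) ≤ q x) :
    IsSingularKernel D (-1 / 2) fun x => Real.log (q x) := by
  have hpos : ∀ x ∈ D, 0 < q x := fun x hx =>
    lt_of_lt_of_le (mul_pos hc (Real.rpow_pos_of_pos (norm_pos_iff.mpr (h0 x hx)) _)) (hlow x hx)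
  obtain ⟨C, hC0, hC⟩ := hq.exists_nonneg_bound
  refine ⟨hq.1.log fun x hx => (hpos x hx).ne', max (C + 4 * c ^ (-1 / 4 : ℝ)) (c⁻¹ * C),
    fun x hx => ⟨?_, ?_⟩⟩
  · have hz : 0 < ‖x.2‖ := norm_pos_iff.mpr (h0 x hx)
    have hone : 1 ≤ ‖x.2‖ ^ (-1 / 2 : ℝ) :=
      Real.one_le_rpow_of_pos_of_le_one_of_nonpos hz (h1 x hx) (by norm_num)
    have hup : Real.log (q x) ≤ C * ‖x.2‖ ^ (-1 / 2 : ℝ) := by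
      calc Real.log (q x) ≤ q x := Real.log_le_self (hpos x hx).le
        _ ≤ C * ‖x.2‖ ^ (2 : ℝ) := (le_abs_self _).trans (hC x hx).1
        _ ≤ C * ‖x.2‖ ^ (-1 / 2 : ℝ) := by
          refine mul_le_mul_of_nonneg_left ?_ hC0
          exact Real.rpow_le_rpow_of_exponent_ge hz (h1 x hx) (by norm_num)
    have hdown : -Real.log (q x) ≤ 4 * c ^ (-1 / 4 : ℝ) * ‖x.2‖ ^ (-1 / 2 : ℝ) := by
      rw [← Real.log_inv]
      calc Real.log (q x)⁻¹ ≤ (q x)⁻¹ ^ (1 / 4 : ℝ) / (1 / 4) :=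
            Real.log_le_rpow_div (inv_nonneg.mpr (hpos x hx).le) (by norm_num)
        _ = 4 * q x ^ (-1 / 4 : ℝ) := by
            rw [Real.inv_rpow (hpos x hx).le, ← Real.rpow_neg (hpos x hx).le]
            ring_nf
        _ ≤ 4 * (c * ‖x.2‖ ^ (2 : ℝ)) ^ (-1 / 4 : ℝ) := by
            gcongr 4 * ?_
            exact Real.rpow_le_rpow_of_nonpos (by positivity) (hlow x hx) (by norm_num)
        _ = 4 * c ^ (-1 / 4 : ℝ) * ‖x.2‖ ^ (-1 / 2 : ℝ) := by
            rw [Real.mul_rpow hc.le (by positivity), ← Real.rpow_mul hz.le]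
            norm_num
            ring
    have hsum : (C + 4 * c ^ (-1 / 4 : ℝ)) * ‖x.2‖ ^ (-1 / 2 : ℝ) ≤
        max (C + 4 * c ^ (-1 / 4 : ℝ)) (c⁻¹ * C) * ‖x.2‖ ^ (-1 / 2 : ℝ) := by
      gcongr
      exact le_max_left _ _
    refine le_trans (abs_le.mpr ⟨?_, ?_⟩) hsum
    · have : 0 ≤ C * ‖x.2‖ ^ (-1 / 2 : ℝ) := by positivity
      linarith
    · have : 0 ≤ 4 * c ^ (-1 / 4 : ℝ) * ‖x.2‖ ^ (-1 / 2 : ℝ) := by positivity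
      linarith
  · have hz : 0 < ‖x.2‖ := norm_pos_iff.mpr (h0 x hx)
    rw [fderiv.log (hq.differentiableAt hD hx) (hpos x hx).ne', norm_smul, norm_inv,
      Real.norm_of_nonneg (hpos x hx).le]
    calc (q x)⁻¹ * ‖fderiv ℝ q x‖
        ≤ (c * ‖x.2‖ ^ (2 : ℝ))⁻¹ * (C * ‖x.2‖ ^ ((2 : ℝ) - 1)) := by
          gcongr
          · exact hlow x hx
          · exact (hC x hx).2
      _ = c⁻¹ * C * (‖x.2‖ ^ (-2 : ℝ) * ‖x.2‖ ^ ((2 : ℝ) - 1)) := by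
          rw [Real.rpow_neg hz.le, mul_inv]
          ring
      _ = c⁻¹ * C * ‖x.2‖ ^ (-1 : ℝ) := by
          rw [← Real.rpow_add hz]
          norm_num
      _ ≤ c⁻¹ * C * ‖x.2‖ ^ (-1 / 2 - 1 : ℝ) := by
          refine mul_le_mul_of_nonneg_left ?_ (by positivity)
          exact Real.rpow_le_rpow_of_exponent_ge hz (h1 x hx) (by norm_num)
      _ ≤ _ := by
          gcongr
          exact le_max_right _ _

/-- No induction is needed: a `t`-derivative is `q⁻¹` times a `t`-derivative of `q`, of order `-2 +
2 = 0`, which `‖z‖ ≤ 1` weakens to `-1 / 2`. -/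
theorem IsParamKernel.log (hD : IsOpen D) (h0 : ∀ x ∈ D, x.2 ≠ 0) (h1 : ∀ x ∈ D, ‖x.2‖ ≤ 1)
    (hq : IsParamKernel D 2 k q) {c : ℝ} (hc : 0 < c)
    (hlow : ∀ x ∈ D, c * ‖x.2‖ ^ (2 : ℝ) ≤ q x) :
    IsParamKernel D (-1 / 2) k fun x => Real.log (q x) := by
  cases k with
  | zero => exact IsSingularKernel.log hD h0 h1 hq hc hlow
  | succ k =>
    refine ⟨hq.1.log hD h0 h1 hc hlow, fun v => ?_⟩
    have h := (hq.of_succ.rpow hD h0 hc hlow (-1)).mul hD h0 (hq.2 v)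
    refine (h.mono_order h0 h1 (by norm_num)).congr hD fun x hx => ?_
    have hpos : 0 < q x :=
      lt_of_lt_of_le (mul_pos hc (Real.rpow_pos_of_pos (norm_pos_iff.mpr (h0 x hx)) _)) (hlow x hx)
    simp only [fderiv.log (hq.1.differentiableAt hD hx) hpos.ne', Pi.mul_apply, Real.rpow_neg_one]
    rfl

end KernelCalculus

/-! ### Functions with bounded derivatives on an open set. -/

section BoundedContDiff

open Metric Filter Topology

variable {X Y W : Type*} [NormedAddCommGroup X] [NormedSpace ℝ X]
  [NormedAddCommGroup Y] [NormedSpace ℝ Y] [NormedAddCommGroup W] [NormedSpace ℝ W]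

/-- `f` is `m` times continuously differentiable on `U`, with bounded derivatives of all orders
at most `m`. -/
def IsBoundedContDiffOn (m : ℕ) (U : Set X) (f : X → W) : Prop :=
  ContDiffOn ℝ m f U ∧ ∃ C, ∀ k ≤ m, ∀ x ∈ U, ‖iteratedFDeriv ℝ k f x‖ ≤ C

theorem isBoundedContDiffOn_of_forall {m : ℕ} {U : Set X} {f : X → W} (hf : ContDiffOn ℝ m f U)
    (h : ∀ k ≤ m, ∃ C, ∀ x ∈ U, ‖iteratedFDeriv ℝ k f x‖ ≤ C) : IsBoundedContDiffOn m U f := by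
  refine ⟨hf, ?_⟩
  choose! C hC using h
  refine ⟨∑ k ∈ Finset.range (m + 1), |C k|, fun k hk x hx => (hC k hk x hx).trans ?_⟩
  exact (le_abs_self _).trans (Finset.single_le_sum (f := fun k => |C k|)
    (fun i _ => abs_nonneg _) (Finset.mem_range.mpr (by omega)))

theorem isBoundedContDiffOn_of_isCompact {m : ℕ} {U T S : Set X} {f : X → W} (hT : IsOpen T)
    (hf : ContDiffOn ℝ m f T) (hS : IsCompact S) (hST : S ⊆ T) (hUS : U ⊆ S) :
    IsBoundedContDiffOn m U f := by
  refine isBoundedContDiffOn_of_forall (hf.mono (hUS.trans hST)) fun k hk => ?_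
  have hc : ContinuousOn (iteratedFDeriv ℝ k f) T :=
    (hf.continuousOn_iteratedFDerivWithin (by exact_mod_cast hk) hT.uniqueDiffOn).congr
      fun x hx => (iteratedFDerivWithin_of_isOpen k hT hx).symm
  obtain ⟨C, hC⟩ := hS.exists_bound_of_continuousOn (hc.mono hST)
  exact ⟨C, fun x hx => hC x (hUS hx)⟩

theorem IsBoundedContDiffOn.comp {m : ℕ} {U : Set X} {V : Set Y} {g : Y → W} {f : X → Y}
    (hU : IsOpen U) (hV : IsOpen V) (hg : IsBoundedContDiffOn m V g)
    (hf : IsBoundedContDiffOn m U f) (h : MapsTo f U V) : IsBoundedContDiffOn m U (g ∘ f) := by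
  obtain ⟨hgs, C, hC⟩ := hg
  obtain ⟨hfs, C', hC'⟩ := hf
  refine isBoundedContDiffOn_of_forall (hgs.comp hfs h) fun k hk =>
    -- The Faà di Bruno estimate wants the `i`-th derivative of `f` bounded by an `i`-th power; a
    -- base at least `1` makes one constant suffice.
    ⟨k.factorial * C * (max 1 C') ^ k, fun x hx => ?_⟩
  rw [← iteratedFDerivWithin_of_isOpen k hU hx]
  refine norm_iteratedFDerivWithin_comp_le hgs hfs (by exact_mod_cast hk) hV.uniqueDiffOn
    hU.uniqueDiffOn h hx (fun i hi => ?_) fun i hi1 hi => ?_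
  · rw [iteratedFDerivWithin_of_isOpen i hV (h hx)]
    exact hC i (hi.trans hk) _ (h hx)
  · rw [iteratedFDerivWithin_of_isOpen i hU hx]
    refine ((hC' i (hi.trans hk) x hx).trans (le_max_right 1 _)).trans ?_
    exact le_self_pow₀ (le_max_left _ _) (by omega)

theorem IsBoundedContDiffOn.smul {m : ℕ} {U : Set X} {a : X → ℝ} {f : X → W}
    (hU : IsOpen U) (ha : IsBoundedContDiffOn m U a) (hf : IsBoundedContDiffOn m U f) :
    IsBoundedContDiffOn m U fun x => a x • f x := by
  obtain ⟨has, C, hC⟩ := ha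
  obtain ⟨hfs, C', hC'⟩ := hf
  refine isBoundedContDiffOn_of_forall (has.smul hfs) fun k hk =>
    ⟨∑ i ∈ Finset.range (k + 1), (k.choose i : ℝ) * C * C', fun x hx => ?_⟩
  rw [← iteratedFDerivWithin_of_isOpen k hU hx]
  refine (norm_iteratedFDerivWithin_smul_le has hfs hU.uniqueDiffOn hx
    (by exact_mod_cast hk)).trans (Finset.sum_le_sum fun i hi => ?_)
  have hi' : i ≤ m := by
    have := Finset.mem_range.mp hi
    omega
  rw [iteratedFDerivWithin_of_isOpen i hU hx, iteratedFDerivWithin_of_isOpen (k - i) hU hx]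
  have h1 := hC i hi' x hx
  have h2 := hC' (k - i) (by omega) x hx
  have h3 : 0 ≤ C := (norm_nonneg _).trans h1
  gcongr

theorem IsBoundedContDiffOn.fderiv_apply {m : ℕ} {U : Set X} {f : X → W} (hU : IsOpen U)
    (hf : IsBoundedContDiffOn (m + 1) U f) (v : X) :
    IsBoundedContDiffOn m U fun x => fderiv ℝ f x v := by
  obtain ⟨hfs, C, hC⟩ := hf
  have hd : ContDiffOn ℝ m (fderiv ℝ f) U := hfs.fderiv_of_isOpen hU (by norm_cast)
  refine ⟨hd.clm_apply contDiffOn_const, ‖v‖ * C, fun k hk x hx => ?_⟩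
  refine (norm_iteratedFDeriv_clm_apply_const (hd.contDiffAt (hU.mem_nhds hx))
    (by exact_mod_cast hk)).trans ?_
  rw [norm_iteratedFDeriv_fderiv]
  gcongr
  exact hC (k + 1) (by omega) x hx

theorem IsBoundedContDiffOn.congr {m : ℕ} {U : Set X} {f g : X → W} (hU : IsOpen U)
    (hf : IsBoundedContDiffOn m U f) (h : EqOn g f U) : IsBoundedContDiffOn m U g := by
  obtain ⟨hfs, C, hC⟩ := hf
  refine ⟨hfs.congr h, C, fun k hk x hx => ?_⟩
  rw [((h.eventuallyEq_of_mem (hU.mem_nhds hx)).iteratedFDeriv ℝ k).eq_of_nhds]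
  exact hC k hk x hx

theorem IsBoundedContDiffOn.extend_zero {m : ℕ} {U B A : Set X} {f : X → W} (hU : IsOpen U)
    (hB : IsOpen B) (hA : IsClosed A) (hAB : A ⊆ B) (hf : IsBoundedContDiffOn m (U ∩ B) f)
    (h0 : ∀ x ∈ U, x ∉ A → f x = 0) : IsBoundedContDiffOn m U f := by
  have hz : ∀ x ∈ U, x ∉ A → f =ᶠ[𝓝 x] fun _ => 0 := by
    intro x hxU hx
    filter_upwards [hA.isOpen_compl.mem_nhds hx, hU.mem_nhds hxU] with y hy hyU using h0 y hyU hy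
  obtain ⟨hfs, C, hC⟩ := hf
  refine ⟨fun x hx => ?_, |C|, fun k hk x hx => ?_⟩
  · by_cases hxA : x ∈ A
    · exact (hfs.contDiffAt ((hU.inter hB).mem_nhds ⟨hx, hAB hxA⟩)).contDiffWithinAt
    · exact (contDiffAt_const.congr_of_eventuallyEq (hz x hx hxA)).contDiffWithinAt
  · by_cases hxA : x ∈ A
    · exact (hC k hk x ⟨hx, hAB hxA⟩).trans (le_abs_self C)
    · rw [((hz x hx hxA).iteratedFDeriv ℝ k).eq_of_nhds]
      simp

theorem IsBoundedContDiffOn.exists_norm_le {m : ℕ} {U : Set X} {f : X → W}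
    (hf : IsBoundedContDiffOn m U f) : ∃ C, ∀ x ∈ U, ‖f x‖ ≤ C := by
  obtain ⟨-, C, hC⟩ := hf
  exact ⟨C, fun x hx => by simpa using hC 0 (Nat.zero_le _) x hx⟩

/-- Each translate of the image of `ι` lies wholly in `U` or wholly outside it, so the jump of `F`
across the boundary of `U` is invisible to tangential derivatives. -/
theorem IsBoundedContDiffOn.isTangentiallyBounded {E : Type*} [NormedAddCommGroup E]
    [NormedSpace ℝ E] [FiniteDimensional ℝ E] [FiniteDimensional ℝ X] [MeasurableSpace X]
    [BorelSpace X] {𝕜 : Type*} [RCLike 𝕜] (ι : E →L[ℝ] X) {U : Set X} (hU : IsOpen U)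
    (hι : ∀ y t, y + ι t ∈ U ↔ y ∈ U) {m : ℕ} {F : X → 𝕜} (hF : IsBoundedContDiffOn m U F)
    (h0 : ∀ y, y ∉ U → F y = 0) : IsTangentiallyBounded ι m F := by
  classical
  have hb : ∀ F : X → 𝕜, ∀ m, IsBoundedContDiffOn m U F → (∀ y, y ∉ U → F y = 0) →
      Measurable F ∧ ∃ C, ∀ y, ‖F y‖ ≤ C := by
    intro F m hF h0
    constructor
    · have h := hF.1.continuousOn.measurable_piecewise (g := fun _ => 0) continuousOn_const
        hU.measurableSet
      convert h using 1
      ext y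
      by_cases hy : y ∈ U
      · rw [piecewise_eq_of_mem _ _ _ hy]
      · rw [piecewise_eq_of_notMem _ _ _ hy, h0 y hy]
    · obtain ⟨C, hC⟩ := hF.exists_norm_le
      refine ⟨|C|, fun y => ?_⟩
      by_cases hy : y ∈ U
      · exact (hC y hy).trans (le_abs_self C)
      · rw [h0 y hy, norm_zero]
        exact abs_nonneg C
  induction m generalizing F with
  | zero => exact hb F 0 hF h0
  | succ m ih =>
    refine ⟨hb F _ hF h0, fun y => if y ∈ U then (fderiv ℝ F y).comp ι else 0, fun y => ?_, ?_,
      fun v => ?_⟩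
    · by_cases hy : y ∈ U
      · simp only [if_pos hy]
        have h1 : HasFDerivAt F (fderiv ℝ F y) (y + ι 0) := by
          rw [map_zero, add_zero]
          exact ((hF.1.contDiffAt (hU.mem_nhds hy)).differentiableAt (by simp)).hasFDerivAt
        exact h1.comp (0 : E) (ι.hasFDerivAt.const_add y)
      · simp only [if_neg hy]
        have h1 : (fun t => F (y + ι t)) = fun _ => 0 := by
          ext t
          exact h0 _ fun h => hy ((hι y t).mp h)
        rw [h1]
        exact hasFDerivAt_const _ _
    · obtain ⟨-, C, hC⟩ := hF
      refine ⟨|C| * ‖ι‖, fun y => ?_⟩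
      by_cases hy : y ∈ U
      · simp only [if_pos hy]
        refine (ContinuousLinearMap.opNorm_comp_le _ _).trans ?_
        gcongr
        rw [← norm_iteratedFDeriv_one]
        exact (hC 1 (by omega) y hy).trans (le_abs_self C)
      · simp only [if_neg hy, norm_zero]
        positivity
    · refine ih ((hF.fderiv_apply hU (ι v)).congr hU fun y hy => ?_) fun y hy => ?_
      · simp [hy]
      · simp [hy]

theorem IsContDiffUpToBoundary.isBoundedContDiffOn {n : ℕ} {𝕜 : Type*} [RCLike 𝕜] {m : ℕ}
    {Ω : Set (EuclideanSpace ℝ (Fin n))} {f : EuclideanSpace ℝ (Fin n) → 𝕜}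
    (hΩ : Bornology.IsBounded Ω) (hf : IsContDiffUpToBoundary m Ω f) :
    IsBoundedContDiffOn m Ω f := by
  refine isBoundedContDiffOn_of_forall hf.1 fun k hk => ?_
  obtain ⟨G, hG, hGf⟩ := hf.2 k hk
  obtain ⟨C, hC⟩ := hΩ.isCompact_closure.exists_bound_of_continuousOn hG
  refine ⟨C, fun x hx => ?_⟩
  rw [hGf hx]
  exact hC x (subset_closure hx)

end BoundedContDiff

/-! ### The Newton kernel, alone and in a chart. -/

section NewtonKernel

open Metric Filter Topology

variable {n : ℕ}

theorem newtonKernel_eq_sub (x y : EuclideanSpace ℝ (Fin n)) :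
    newtonKernel n x y = newtonKernel n (x - y) 0 := by
  simp [newtonKernel]

theorem newtonKernel_of_ne_two (hn : n ≠ 2) (x y : EuclideanSpace ℝ (Fin n)) :
    newtonKernel n x y = 1 / unitSphereArea n / (2 - (n : ℝ)) *
      (‖x - y‖ ^ 2) ^ ((2 - (n : ℝ)) / 2) := by
  rw [newtonKernel, if_neg hn, ← Real.rpow_natCast ‖x - y‖ 2, ← Real.rpow_mul (norm_nonneg _),
    ← Real.rpow_intCast]
  push_cast
  rw [show (2 : ℝ) * ((2 - (n : ℝ)) / 2) = 2 - n by ring]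
  ring

theorem newtonKernel_two (x y : EuclideanSpace ℝ (Fin 2)) :
    newtonKernel 2 x y = 1 / (4 * Real.pi) * Real.log (‖x - y‖ ^ 2) := by
  rw [newtonKernel, if_pos rfl, Real.log_pow]
  push_cast
  field_simp
  ring

theorem contDiffOn_newtonKernel :
    ContDiffOn ℝ ∞ (fun z : EuclideanSpace ℝ (Fin n) => newtonKernel n z 0) {0}ᶜ := by
  have hpos : ∀ z ∈ ({0}ᶜ : Set (EuclideanSpace ℝ (Fin n))), ‖z‖ ^ 2 ≠ 0 := by
    intro z hz
    simpa using hz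
  have hsq : ContDiffOn ℝ ∞ (fun z : EuclideanSpace ℝ (Fin n) => ‖z‖ ^ 2) {0}ᶜ :=
    (contDiff_norm_sq ℝ).contDiffOn
  by_cases hn : n = 2
  · subst hn
    simp_rw [newtonKernel_two, sub_zero]
    exact contDiffOn_const.mul (hsq.log hpos)
  · simp_rw [newtonKernel_of_ne_two hn, sub_zero]
    exact contDiffOn_const.mul (hsq.rpow_const_of_ne hpos)

theorem abs_log_le_rpow {r : ℝ} (hr : 0 < r) :
    |Real.log r| ≤ 2 * r ^ (1 / 2 : ℝ) + 2 * r ^ (-1 / 2 : ℝ) := by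
  have h1 := Real.log_le_rpow_div hr.le (by norm_num : (0 : ℝ) < 1 / 2)
  have h2 := Real.log_le_rpow_div (inv_pos.mpr hr).le (by norm_num : (0 : ℝ) < 1 / 2)
  rw [Real.log_inv, Real.inv_rpow hr.le, ← Real.rpow_neg hr.le] at h2
  have h3 : 0 < r ^ (1 / 2 : ℝ) := Real.rpow_pos_of_pos hr _
  have h4 : 0 < r ^ (-1 / 2 : ℝ) := Real.rpow_pos_of_pos hr _
  rw [show -(1 / 2 : ℝ) = -1 / 2 by norm_num] at h2
  rw [abs_le]
  constructor <;> linarith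

theorem integrableOn_newtonKernel_ball (hn : 2 ≤ n) (r : ℝ) :
    IntegrableOn (fun z : EuclideanSpace ℝ (Fin n) => newtonKernel n z 0) (ball 0 r) := by
  have : Nontrivial (EuclideanSpace ℝ (Fin n)) :=
    Module.nontrivial_of_finrank_pos (R := ℝ) (by simp; omega)
  have hn0 : (2 : ℝ) ≤ n := by exact_mod_cast hn
  have hm := (aestronglyMeasurable_of_continuousOn_compl_zero
    (μ := (volume : Measure (EuclideanSpace ℝ (Fin n)))) contDiffOn_newtonKernel.continuousOn)
  have hae : ∀ᵐ z : EuclideanSpace ℝ (Fin n) ∂volume.restrict (ball 0 r), z ≠ 0 := by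
    refine ae_restrict_of_ae ?_
    rw [ae_iff]
    simp
  have hi : ∀ p : ℝ, -(n : ℝ) < p →
      IntegrableOn (fun z : EuclideanSpace ℝ (Fin n) => ‖z‖ ^ p) (ball 0 r) := fun p hp =>
    integrableOn_norm_rpow_ball (by simpa using hp) r
  by_cases h2 : n = 2
  · subst h2
    refine (((hi (1 / 2) (by norm_num)).const_mul 2).add
      ((hi (-1 / 2) (by norm_num)).const_mul 2) |>.const_mul |1 / (2 * Real.pi)|).mono' hm.restrict ?_
    filter_upwards [hae] with z hz
    rw [newtonKernel, if_pos rfl, sub_zero, norm_mul, Real.norm_eq_abs, Real.norm_eq_abs]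
    exact mul_le_mul_of_nonneg_left (abs_log_le_rpow (norm_pos_iff.mpr hz)) (abs_nonneg _)
  · refine ((hi (2 - n) (by linarith)).const_mul |1 / unitSphereArea n / (2 - (n : ℝ))|).mono'
      hm.restrict (Eventually.of_forall fun z => ?_)
    rw [newtonKernel, if_neg h2, sub_zero, ← Real.rpow_intCast]
    push_cast
    rw [show 1 / unitSphereArea n * (‖z‖ ^ (2 - (n : ℝ)) / (2 - (n : ℝ))) =
      1 / unitSphereArea n / (2 - (n : ℝ)) * ‖z‖ ^ (2 - (n : ℝ)) by ring, norm_mul,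
      Real.norm_eq_abs, Real.norm_of_nonneg (by positivity)]

theorem integrableOn_newtonKernel_smul {𝕜 : Type*} [RCLike 𝕜] (hn : 2 ≤ n)
    {Ω : Set (EuclideanSpace ℝ (Fin n))} (hΩ : MeasurableSet Ω) (hb : Bornology.IsBounded Ω)
    {f : EuclideanSpace ℝ (Fin n) → 𝕜} (hf : AEStronglyMeasurable f (volume.restrict Ω))
    {C : ℝ} (hC : ∀ x ∈ Ω, ‖f x‖ ≤ C) (x : EuclideanSpace ℝ (Fin n)) :
    IntegrableOn (fun y => newtonKernel n x y • f y) Ω := by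
  obtain ⟨r, hr⟩ := hb.subset_ball x
  have h1 := (integrable_indicator_iff measurableSet_ball).mpr (integrableOn_newtonKernel_ball hn r)
  have h2 : IntegrableOn (fun y => newtonKernel n x y) Ω := by
    refine (h1.comp_sub_left x).integrableOn.congr_fun (fun y hy => ?_) hΩ
    have : x - y ∈ ball (0 : EuclideanSpace ℝ (Fin n)) r := by
      have := hr hy
      rw [mem_ball_comm, mem_ball_iff_norm] at this
      rwa [mem_ball_zero_iff]
    simp only [indicator_of_mem this]
    exact (newtonKernel_eq_sub x y).symm
  exact h2.smul_bdd C hf ((ae_restrict_iff' hΩ).mpr (Eventually.of_forall hC))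

/-- The kernel is a power or a logarithm of `q = ‖Ψ (ι t) - Ψ (ι t - z)‖ ^ 2`, a sum of squares of
order-one differences, bounded below by `hlow`. The order `3 / 2 - n` is that of the logarithm for
`n = 2` and a weakening of `2 - n` otherwise; one derivative leaves `1 / 2 - n > -n`. -/
theorem exists_isParamKernel_newtonKernel (hn : 2 ≤ n) {E : Type*} [NormedAddCommGroup E]
    [NormedSpace ℝ E] [FiniteDimensional ℝ E] (ι : E →L[ℝ] EuclideanSpace ℝ (Fin n))
    {Ψ : EuclideanSpace ℝ (Fin n) → EuclideanSpace ℝ (Fin n)}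
    {T : Set (EuclideanSpace ℝ (Fin n))} (hT : IsOpen T) (hΨ : ContDiffOn ℝ ∞ Ψ T) (t₀ : E)
    {ρ : ℝ} (hρ : 0 < ρ) (hρT : closedBall (ι t₀) ρ ⊆ T) {c : ℝ} (hc : 0 < c)
    (hlow : ∀ y ∈ closedBall (ι t₀) ρ, ∀ y' ∈ closedBall (ι t₀) ρ, c * ‖y - y'‖ ≤ ‖Ψ y - Ψ y'‖) :
    ∃ r > 0, ∃ K : E × EuclideanSpace ℝ (Fin n) → ℝ,
      (∀ k, IsParamKernel {x : E × EuclideanSpace ℝ (Fin n) | x.2 ≠ 0} (3 / 2 - n) k K) ∧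
      (∀ x : E × EuclideanSpace ℝ (Fin n), 1 < ‖x.2‖ → K x = 0) ∧
      ∀ t z, ‖t - t₀‖ ≤ r → ‖z‖ ≤ r → K (t, z) = newtonKernel n (Ψ (ι t)) (Ψ (ι t - z)) := by
  have hn0 : (2 : ℝ) ≤ n := by exact_mod_cast hn
  -- If `‖t - t₀‖` and `‖z‖` are below `R`, then `ι t` and `ι t - z` stay within `ρ` of `ι t₀`; the
  -- cap `1` is for the comparison of orders.
  set R : ℝ := min 1 (ρ / (‖ι‖ + 1))
  have hι : 0 < ‖ι‖ + 1 := by positivity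
  have hR0 : 0 < R := lt_min one_pos (div_pos hρ hι)
  have hR1 : R ≤ 1 := min_le_left _ _
  have hRρ : (‖ι‖ + 1) * R ≤ ρ := by
    rw [mul_comm, ← le_div_iff₀ hι]
    exact min_le_right _ _
  set U : Set (E × EuclideanSpace ℝ (Fin n)) := ball (t₀, 0) R with hU
  have hU1 : ∀ x ∈ U, ‖x.1 - t₀‖ < R ∧ ‖x.2‖ < R := by
    intro x hx
    rw [hU, mem_ball_iff_norm, Prod.norm_def, max_lt_iff] at hx
    simpa using hx
  set D := {x : E × EuclideanSpace ℝ (Fin n) | x.2 ≠ 0} ∩ U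
  have hD : IsOpen D := isOpen_snd_ne_zero.inter isOpen_ball
  have hD0 : ∀ x ∈ D, x.2 ≠ 0 := fun x hx => hx.1
  have hD1 : ∀ x ∈ D, ‖x.2‖ ≤ 1 := fun x hx => ((hU1 x hx.2).2.le).trans hR1
  have hm1 : ∀ x ∈ D, ι x.1 ∈ closedBall (ι t₀) ρ := by
    intro x hx
    rw [mem_closedBall_iff_norm, ← map_sub]
    refine (ι.le_opNorm _).trans (le_trans ?_ hRρ)
    have := (hU1 x hx.2).1.le
    gcongr
    linarith
  have hm2 : ∀ x ∈ D, ι x.1 - x.2 ∈ closedBall (ι t₀) ρ := by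
    intro x hx
    rw [mem_closedBall_iff_norm, sub_right_comm, ← map_sub]
    refine (norm_sub_le _ _).trans (le_trans ?_ hRρ)
    obtain ⟨h1, h2⟩ := hU1 x hx.2
    have h3 : ‖ι (x.1 - t₀)‖ ≤ ‖ι‖ * R := (ι.le_opNorm _).trans (by gcongr)
    linarith
  set q : E × EuclideanSpace ℝ (Fin n) → ℝ := fun x => ‖Ψ (ι x.1) - Ψ (ι x.1 - x.2)‖ ^ 2 with hq
  have hqk : ∀ k, IsParamKernel D 2 k q := by
    intro k
    have h := IsParamKernel.sum (k := k) (p := 1 + 1) (Finset.univ : Finset (Fin n)) hD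
      (K := fun i => (fun x => Ψ (ι x.1) i - Ψ (ι x.1 - x.2) i) *
        fun x => Ψ (ι x.1) i - Ψ (ι x.1 - x.2) i) fun i => by
          have hψ : ContDiffOn ℝ ∞ (fun y => Ψ y i) T :=
            (EuclideanSpace.proj (𝕜 := ℝ) i : EuclideanSpace ℝ (Fin n) →L[ℝ] ℝ).contDiff.comp_contDiffOn
              hΨ
          have h1 := IsParamKernel.difference (k := k) ι hT hρT hψ hD hm1 hm2
          exact h1.mul hD hD0 h1
    rw [show (1 : ℝ) + 1 = 2 by norm_num] at h
    refine h.congr hD fun x _ => ?_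
    simp only [hq, EuclideanSpace.real_norm_sq_eq, PiLp.sub_apply]
    simp only [Pi.mul_apply, sq]
  have hqlow : ∀ x ∈ D, c ^ 2 * ‖x.2‖ ^ (2 : ℝ) ≤ q x := by
    intro x hx
    have h := hlow _ (hm1 x hx) _ (hm2 x hx)
    rw [sub_sub_cancel] at h
    rw [Real.rpow_two, ← mul_pow]
    exact pow_le_pow_left₀ (by positivity) h 2
  have hN : ∀ k, IsParamKernel D (3 / 2 - n) k
      fun x => newtonKernel n (Ψ (ι x.1)) (Ψ (ι x.1 - x.2)) := by
    intro k
    by_cases h2 : n = 2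
    · subst h2
      have h := ((hqk k).log hD hD0 hD1 (by positivity) hqlow).const_mul hD hD0 (1 / (4 * Real.pi))
      simp_rw [newtonKernel_two]
      refine h.mono_order hD0 hD1 (by norm_num)
    · have h := ((hqk k).rpow hD hD0 (by positivity) hqlow ((2 - (n : ℝ)) / 2)).const_mul hD hD0
        (1 / unitSphereArea n / (2 - (n : ℝ)))
      simp_rw [newtonKernel_of_ne_two h2]
      refine h.mono_order hD0 hD1 (by linarith)
  let a : ContDiffBump ((t₀, 0) : E × EuclideanSpace ℝ (Fin n)) :=
    ⟨R / 3, R / 2, by positivity, by linarith⟩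
  refine ⟨R / 3, by positivity,
    (a : E × EuclideanSpace ℝ (Fin n) → ℝ) * fun x => newtonKernel n (Ψ (ι x.1)) (Ψ (ι x.1 - x.2)),
    fun k => ?_, fun x hx => ?_, fun t z ht hz => ?_⟩
  · refine IsParamKernel.extend_zero (U := U) (A := closedBall (t₀, 0) (R / 2)) isOpen_snd_ne_zero
      isOpen_ball isClosed_closedBall (closedBall_subset_ball (by linarith)) ?_ fun x hx => ?_
    · have h := (IsParamKernel.of_contDiff_of_hasCompactSupport (k := k) hD0 hD1 a.contDiff
        a.hasCompactSupport).mul hD hD0 (hN k)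
      rwa [zero_add] at h
    · have : a x = 0 := a.zero_of_le_dist (by simpa using le_of_not_ge hx)
      rw [Pi.mul_apply, this, zero_mul]
  · have : a x = 0 := by
      refine a.zero_of_le_dist ?_
      rw [dist_eq_norm]
      refine le_trans ?_ (norm_snd_le _)
      change R / 2 ≤ ‖x.2 - 0‖
      rw [sub_zero]
      linarith
    rw [Pi.mul_apply, this, zero_mul]
  · have : a (t, z) = 1 := by
      refine a.one_of_mem_closedBall ?_
      rw [mem_closedBall_iff_norm, Prod.norm_def]
      simpa using ⟨ht, hz⟩
    rw [Pi.mul_apply, this, one_mul]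

end NewtonKernel

/-! ### Smoothness away from the support of the density. -/

section FarField

open Metric Filter Topology
open scoped Convolution

variable {n : ℕ} {𝕜 : Type*} [RCLike 𝕜]

theorem contDiffAt_integral_newtonKernel_of_eq_zero {x₀ : EuclideanSpace ℝ (Fin n)}
    {g : EuclideanSpace ℝ (Fin n) → 𝕜} (hg : Integrable g) {δ R : ℝ} (hδ : 0 < δ) (hR : 0 < R)
    (hnear : ∀ y, ‖y - x₀‖ < δ → g y = 0) (hfar : ∀ y, R < ‖y - x₀‖ → g y = 0) :
    ContDiffAt ℝ ∞ (fun x => ∫ y, newtonKernel n x y • g y) x₀ := by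
  -- For `‖x - x₀‖ < δ / 2` and `y` with `g y ≠ 0`, `‖x - y‖` lies between `δ / 2` and `R + δ`.
  -- There `b₁ = 0` and `b₂ = 1`, so the kernel may be replaced by the smooth, compactly supported
  -- `κ`.
  let b₁ : ContDiffBump (0 : EuclideanSpace ℝ (Fin n)) :=
    ⟨δ / 4, δ / 2, by positivity, by linarith⟩
  let b₂ : ContDiffBump (0 : EuclideanSpace ℝ (Fin n)) :=
    ⟨R + δ, R + δ + 1, by positivity, by linarith⟩
  set κ : EuclideanSpace ℝ (Fin n) → ℝ := fun z => b₂ z * ((1 - b₁ z) * newtonKernel n z 0) with hκ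
  have hκs : ContDiff ℝ ∞ κ := by
    rw [contDiff_iff_contDiffAt]
    intro z
    refine b₂.contDiff.contDiffAt.mul ?_
    by_cases hz : z = 0
    · refine (contDiffAt_const (c := (0 : ℝ))).congr_of_eventuallyEq ?_
      have : ball (0 : EuclideanSpace ℝ (Fin n)) (δ / 4) ∈ 𝓝 z :=
        isOpen_ball.mem_nhds (by rw [hz]; exact mem_ball_self (by positivity))
      filter_upwards [this] with y hy
      rw [b₁.one_of_mem_closedBall (ball_subset_closedBall hy), sub_self, zero_mul]
    · exact (contDiffAt_const.sub b₁.contDiff.contDiffAt).mul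
        (contDiffOn_newtonKernel.contDiffAt (isOpen_compl_singleton.mem_nhds hz))
  have hκc : HasCompactSupport κ := b₂.hasCompactSupport.mul_right
  have hconv := hκc.contDiff_convolution_right (n := ⊤)
    (ContinuousLinearMap.lsmul ℝ ℝ : ℝ →L[ℝ] 𝕜 →L[ℝ] 𝕜).flip hg.locallyIntegrable
    (μ := volume) hκs
  refine hconv.contDiffAt.congr_of_eventuallyEq ?_
  filter_upwards [ball_mem_nhds x₀ (half_pos hδ)] with x hx
  refine integral_congr_ae (Eventually.of_forall fun y => ?_)
  change newtonKernel n x y • g y = κ (x - y) • g y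
  rw [mem_ball_iff_norm] at hx
  by_cases hy : g y = 0
  · rw [hy, smul_zero, smul_zero]
  have h1 : δ ≤ ‖y - x₀‖ := not_lt.mp fun h => hy (hnear y h)
  have h2 : ‖y - x₀‖ ≤ R := not_lt.mp fun h => hy (hfar y h)
  have h3 : b₁ (x - y) = 0 := by
    refine b₁.zero_of_le_dist ?_
    rw [dist_zero_right]
    change δ / 2 ≤ _
    have := norm_sub_norm_le (y - x₀) (x - x₀)
    rw [sub_sub_sub_cancel_right, norm_sub_rev y x] at this
    linarith
  have h4 : b₂ (x - y) = 1 := by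
    refine b₂.one_of_mem_closedBall ?_
    rw [mem_closedBall_zero_iff]
    change _ ≤ R + δ
    have := norm_sub_le (x - x₀) (y - x₀)
    rw [sub_sub_sub_cancel_right] at this
    linarith
  simp only [hκ, h3, h4, one_mul, sub_zero]
  rw [← newtonKernel_eq_sub]

end FarField

/-! ### The Jacobian determinant. -/

section Determinant

variable {P X : Type*} [NormedAddCommGroup P] [NormedSpace ℝ P] [NormedAddCommGroup X]
  [NormedSpace ℝ X] [FiniteDimensional ℝ X]

theorem ContinuousLinearMap.contDiff_det : ContDiff ℝ ∞ fun A : X →L[ℝ] X => A.det := by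
  let b := Module.finBasis ℝ X
  have h : (fun A : X →L[ℝ] X => A.det) = fun A : X →L[ℝ] X =>
      ∑ σ : Equiv.Perm (Fin (Module.finrank ℝ X)), ((Equiv.Perm.sign σ : ℤ) : ℝ) *
        ∏ i, LinearMap.toContinuousLinearMap (b.coord (σ i)) (A (b i)) := by
    ext A
    rw [ContinuousLinearMap.det, ← LinearMap.det_toMatrix b, Matrix.det_apply']
    simp [LinearMap.toMatrix_apply]
  rw [h]
  refine ContDiff.sum fun σ _ => contDiff_const.mul (contDiff_prod fun i _ => ?_)
  exact (ContinuousLinearMap.contDiff _).comp (contDiff_id.clm_apply contDiff_const)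

theorem det_fderiv_ne_zero_of_leftInverse {Ψ Θ : X → X} {y : X} (hΨ : DifferentiableAt ℝ Ψ y)
    (hΘ : DifferentiableAt ℝ Θ (Ψ y)) (h : ∀ᶠ y' in nhds y, Θ (Ψ y') = y') :
    (fderiv ℝ Ψ y).det ≠ 0 := by
  have h1 : (fderiv ℝ Θ (Ψ y)).comp (fderiv ℝ Ψ y) = ContinuousLinearMap.id ℝ X := by
    rw [← fderiv_comp y hΘ hΨ,
      Filter.EventuallyEq.fderiv_eq (f := id) (f₁ := Θ ∘ Ψ) h, fderiv_id]
  have h2 := congrArg ContinuousLinearMap.det h1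
  have h3 : (fderiv ℝ Θ (Ψ y)).det * (fderiv ℝ Ψ y).det = 1 := by
    rw [ContinuousLinearMap.det, ContinuousLinearMap.det, ← LinearMap.det_comp]
    simpa [ContinuousLinearMap.det] using h2
  exact right_ne_zero_of_mul_eq_one h3

end Determinant

/-! ### The potential near a boundary point, in a straightened chart. -/

section NearField

open Metric Filter Topology

variable {n : ℕ} {𝕜 : Type*} [RCLike 𝕜]

/-- After `y = ι t - z`, smallness of the support of `F` and of `t - t₀` confines `z` to the region
where the cut-off kernel equals the Newton kernel. -/
theorem contDiffAt_integral_newtonKernel_chart (hn : 2 ≤ n) {E : Type*} [NormedAddCommGroup E]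
    [NormedSpace ℝ E] [FiniteDimensional ℝ E] (ι : E →L[ℝ] EuclideanSpace ℝ (Fin n))
    {Ψ : EuclideanSpace ℝ (Fin n) → EuclideanSpace ℝ (Fin n)}
    {T : Set (EuclideanSpace ℝ (Fin n))} (hT : IsOpen T) (hΨ : ContDiffOn ℝ ∞ Ψ T) (t₀ : E)
    {ρ : ℝ} (hρ : 0 < ρ) (hρT : closedBall (ι t₀) ρ ⊆ T) {c : ℝ} (hc : 0 < c)
    (hlow : ∀ y ∈ closedBall (ι t₀) ρ, ∀ y' ∈ closedBall (ι t₀) ρ, c * ‖y - y'‖ ≤ ‖Ψ y - Ψ y'‖)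
    (m : ℕ) : ∃ r > 0, ∀ F : EuclideanSpace ℝ (Fin n) → 𝕜, IsTangentiallyBounded ι m F →
      (∀ y, F y ≠ 0 → ‖y - ι t₀‖ ≤ r) →
      ContDiffAt ℝ (m + 1) (fun t => ∫ y, newtonKernel n (Ψ (ι t)) (Ψ y) • F y) t₀ := by
  have : Nontrivial (EuclideanSpace ℝ (Fin n)) :=
    Module.nontrivial_of_finrank_pos (R := ℝ) (by simp; omega)
  obtain ⟨r, hr, K, hK, hK1, hKN⟩ :=
    exists_isParamKernel_newtonKernel hn ι hT hΨ t₀ hρ hρT hc hlow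
  refine ⟨r / 2, by positivity, fun F hF hFr => ?_⟩
  have h := contDiff_paramIntegral (μ := volume) ι (p := 3 / 2 - n) (by simp; linarith) m (hK m)
    hK1 hF
  refine h.contDiffAt.congr_of_eventuallyEq ?_
  have hι : 0 < 2 * (‖ι‖ + 1) := by positivity
  filter_upwards [ball_mem_nhds t₀ (div_pos hr hι)] with t ht
  rw [mem_ball_iff_norm, lt_div_iff₀ hι] at ht
  rw [paramIntegral, ← integral_sub_left_eq_self _ volume (ι t)]
  refine integral_congr_ae (Eventually.of_forall fun z => ?_)
  by_cases hz : F (ι t - z) = 0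
  · simp [hz]
  have h1 := hFr _ hz
  have h2 : ‖ι t - ι t₀‖ ≤ ‖ι‖ * ‖t - t₀‖ := by
    rw [← map_sub]
    exact ι.le_opNorm _
  have h3 : ‖t - t₀‖ ≤ r := by
    nlinarith [norm_nonneg (t - t₀), norm_nonneg ι, mul_nonneg (norm_nonneg (t - t₀)) (norm_nonneg ι)]
  have h4 : ‖z‖ ≤ r := by
    have h5 := norm_sub_le (ι t - ι t₀) (ι t - z - ι t₀)
    rw [sub_sub_sub_cancel_right, sub_sub_cancel] at h5
    nlinarith [norm_nonneg (t - t₀)]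
  simp only [hKN t z h3 h4]

/-- A change of variables in the Newtonian potential of a density supported in the domain of a
chart. -/
theorem setIntegral_newtonKernel_eq_integral_chart
    (Θ : OpenPartialHomeomorph (EuclideanSpace ℝ (Fin n)) (EuclideanSpace ℝ (Fin n)))
    (hΘ' : ContDiffOn ℝ ∞ Θ.symm Θ.target) {H B Ω : Set (EuclideanSpace ℝ (Fin n))}
    (hH : MeasurableSet H) (hB : MeasurableSet B) (hΩm : MeasurableSet Ω) (hBT : B ⊆ Θ.target)
    (hΩ : ∀ y ∈ Θ.target, Θ.symm y ∈ Ω ↔ y ∈ H) {g : EuclideanSpace ℝ (Fin n) → 𝕜}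
    (hg : ∀ x, x ∉ Θ.symm '' B → g x = 0) (x : EuclideanSpace ℝ (Fin n)) :
    ∫ y in Ω, newtonKernel n x y • g y = ∫ y, newtonKernel n x (Θ.symm y) •
      (H ∩ B).indicator (fun y => |(fderiv ℝ Θ.symm y).det| • g (Θ.symm y)) y := by
  have himg : Θ.symm '' (H ∩ B) ⊆ Ω := by
    rintro _ ⟨y, hy, rfl⟩
    exact (hΩ y (hBT hy.2)).mpr hy.1
  -- The integrand vanishes on `Ω` outside the image of `H ∩ B`, where the change of variables
  -- applies.
  rw [setIntegral_eq_of_subset_of_forall_sdiff_eq_zero hΩm himg fun y hy => ?_,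
    integral_image_eq_integral_abs_det_fderiv_smul volume (hH.inter hB) (f := Θ.symm)
      (f' := fderiv ℝ Θ.symm) (fun y hy => ?_) (Θ.symm.injOn.mono fun y hy => hBT hy.2),
    ← integral_indicator (hH.inter hB)]
  · refine integral_congr_ae (Eventually.of_forall fun y => ?_)
    by_cases hy : y ∈ H ∩ B
    · simp only [indicator_of_mem hy]
      exact smul_comm _ _ _
    · simp only [indicator_of_notMem hy, smul_zero]
  · exact ((hΘ'.contDiffAt (Θ.open_target.mem_nhds (hBT hy.2))).differentiableAt
      (by simp)).hasFDerivAt.hasFDerivWithinAt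
  · rw [hg y fun ⟨z, hz, hzy⟩ => hy.2 ⟨z, ⟨?_, hz⟩, hzy⟩, smul_zero]
    rw [← hΩ z (hBT hz), hzy]
    exact hy.1

/-- A cutoff `η` equal to `1` near `x₀` separates near and far fields. It is `χ` transported by the
chart, so the pulled-back near density is the Jacobian times `χ` times `f ∘ Θ.symm` on the half
space. -/
theorem contDiffAt_newtonPotential_chart (hn : 2 ≤ n) {E : Type*} [NormedAddCommGroup E]
    [NormedSpace ℝ E] [FiniteDimensional ℝ E] (ι : E →L[ℝ] EuclideanSpace ℝ (Fin n))
    (Θ : OpenPartialHomeomorph (EuclideanSpace ℝ (Fin n)) (EuclideanSpace ℝ (Fin n)))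
    (hΘ : ContDiffOn ℝ ∞ Θ Θ.source) (hΘ' : ContDiffOn ℝ ∞ Θ.symm Θ.target)
    {H Ω : Set (EuclideanSpace ℝ (Fin n))} (hH : IsOpen H) (hι : ∀ y t, y + ι t ∈ H ↔ y ∈ H)
    (hΩo : IsOpen Ω) (hΩb : Bornology.IsBounded Ω) (hΩ : ∀ y ∈ Θ.target, Θ.symm y ∈ Ω ↔ y ∈ H)
    {m : ℕ} {f : EuclideanSpace ℝ (Fin n) → 𝕜} (hf : IsBoundedContDiffOn m Ω f) {t₀ : E}
    (ht₀ : ι t₀ ∈ Θ.target) :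
    ContDiffAt ℝ (m + 1) (fun t => newtonPotential Ω f (Θ.symm (ι t))) t₀ := by
  classical
  set x₀ := Θ.symm (ι t₀) with hx₀
  have hx₀s : x₀ ∈ Θ.source := Θ.map_target ht₀
  -- A local Lipschitz bound for `Θ` is a lower bound for distances under `Θ.symm`; `L + 1` is used
  -- below because `L` may be zero.
  obtain ⟨L, V, hV, hLV⟩ := ((hΘ.contDiffAt (Θ.open_source.mem_nhds hx₀s)).of_le
    (m := 1) (by exact_mod_cast le_top)).exists_lipschitzOnWith
  obtain ⟨ρ, hρ, hρT⟩ := Metric.nhds_basis_closedBall.mem_iff.mp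
    (inter_mem (Θ.open_target.mem_nhds ht₀) ((Θ.continuousAt_symm ht₀).preimage_mem_nhds hV))
  have hT : closedBall (ι t₀) ρ ⊆ Θ.target := fun y hy => (hρT hy).1
  have hL : (0 : ℝ) < L + 1 := by positivity
  obtain ⟨r, hr, hnear⟩ := contDiffAt_integral_newtonKernel_chart (𝕜 := 𝕜) hn ι Θ.open_target hΘ'
    t₀ hρ hT (c := 1 / (L + 1)) (by positivity) (fun y hy y' hy' => by
      have h := hLV.dist_le_mul _ (hρT hy).2 _ (hρT hy').2
      rw [Θ.right_inv (hT hy), Θ.right_inv (hT hy'), dist_eq_norm, dist_eq_norm] at h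
      rw [one_div, inv_mul_le_iff₀ hL, add_mul, one_mul]
      exact h.trans (le_add_of_nonneg_right (norm_nonneg _))) m
  set s : ℝ := min ρ r / 2
  have hs0 : 0 < s := by positivity
  have hsρ : s < ρ := lt_of_lt_of_le (half_lt_self (by positivity)) (min_le_left _ _)
  have hsr : s ≤ r := (half_le_self (by positivity)).trans (min_le_right _ _)
  let χ : ContDiffBump (ι t₀) := ⟨s / 2, s, by positivity, by linarith⟩
  set B := ball (ι t₀) ρ
  have hBT : B ⊆ Θ.target := ball_subset_closedBall.trans hT
  have hSB : Θ.symm '' B = Θ.source ∩ Θ ⁻¹' B := Θ.symm.image_eq_target_inter_inv_preimage hBT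
  have hSBo : IsOpen (Θ.symm '' B) := by
    rw [hSB]
    exact Θ.isOpen_inter_preimage isOpen_ball
  -- Measurability and `0 ≤ η ≤ 1` suffice globally; smoothness is only used for `χ`, in the chart.
  set η : EuclideanSpace ℝ (Fin n) → ℝ := (Θ.symm '' B).piecewise (fun x => χ (Θ x)) 0 with hη
  have hηm : Measurable η := by
    refine ContinuousOn.measurable_piecewise ?_ continuousOn_const hSBo.measurableSet
    refine χ.continuous.comp_continuousOn (Θ.continuousOn.mono ?_)
    rw [hSB]
    exact inter_subset_left
  have hη01 : ∀ x, 0 ≤ η x ∧ η x ≤ 1 := by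
    intro x
    by_cases hx : x ∈ Θ.symm '' B
    · simp only [hη, piecewise_eq_of_mem _ _ _ hx]
      exact ⟨χ.nonneg, χ.le_one⟩
    · have : η x = 0 := by
        rw [hη, piecewise_eq_of_notMem _ _ _ hx]
        rfl
      simp [this]
  obtain ⟨M, hM⟩ := hf.exists_norm_le
  have hfm : AEStronglyMeasurable f (volume.restrict Ω) :=
    hf.1.continuousOn.aestronglyMeasurable hΩo.measurableSet
  have hg₁m : AEStronglyMeasurable (fun y => η y • f y) (volume.restrict Ω) :=
    hηm.aestronglyMeasurable.smul hfm
  have hg₂m : AEStronglyMeasurable (fun y => (1 - η y) • f y) (volume.restrict Ω) :=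
    (measurable_const.sub hηm).aestronglyMeasurable.smul hfm
  have hg₁b : ∀ y ∈ Ω, ‖η y • f y‖ ≤ M := fun y hy => by
    rw [norm_smul, Real.norm_of_nonneg (hη01 y).1]
    exact (mul_le_of_le_one_left (norm_nonneg _) (hη01 y).2).trans (hM y hy)
  have hg₂b : ∀ y ∈ Ω, ‖(1 - η y) • f y‖ ≤ M := fun y hy => by
    rw [norm_smul, Real.norm_of_nonneg (by linarith [(hη01 y).2])]
    exact (mul_le_of_le_one_left (norm_nonneg _) (by linarith [(hη01 y).1])).trans (hM y hy)
  have hsplit : ∀ x, newtonPotential Ω f x = (∫ y in Ω, newtonKernel n x y • η y • f y) +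
      ∫ y, newtonKernel n x y • Ω.indicator (fun y => (1 - η y) • f y) y := by
    intro x
    have h1 : ∫ y, newtonKernel n x y • Ω.indicator (fun y => (1 - η y) • f y) y =
        ∫ y in Ω, newtonKernel n x y • (1 - η y) • f y := by
      rw [← integral_indicator hΩo.measurableSet]
      refine integral_congr_ae (Eventually.of_forall fun y => ?_)
      by_cases hy : y ∈ Ω
      · simp only [indicator_of_mem hy]
      · simp only [indicator_of_notMem hy, smul_zero]
    rw [h1, ← integral_add
      (integrableOn_newtonKernel_smul hn hΩo.measurableSet hΩb hg₁m hg₁b x)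
      (integrableOn_newtonKernel_smul hn hΩo.measurableSet hΩb hg₂m hg₂b x)]
    refine integral_congr_ae (Eventually.of_forall fun y => ?_)
    simp only [← smul_add, ← add_smul]
    simp
  have hΨι : ContDiffAt ℝ ∞ (fun t => Θ.symm (ι t)) t₀ :=
    (hΘ'.contDiffAt (Θ.open_target.mem_nhds ht₀)).comp t₀ ι.contDiff.contDiffAt
  simp_rw [hsplit]
  refine ContDiffAt.add ?_ ?_
  · simp_rw [setIntegral_newtonKernel_eq_integral_chart Θ hΘ' hH.measurableSet
      (B := B) measurableSet_ball hΩo.measurableSet hBT hΩ (g := fun y => η y • f y)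
      fun x hx => by simp only [hη, piecewise_eq_of_notMem _ _ _ hx, Pi.zero_apply, zero_smul]]
    have hηΨ : ∀ y ∈ B, η (Θ.symm y) = χ y := fun y hy => by
      rw [hη, piecewise_eq_of_mem _ _ _ (mem_image_of_mem _ hy), Θ.right_inv (hBT hy)]
    have hzero : ∀ y, y ∉ H ∩ closedBall (ι t₀) s → (H ∩ B).indicator
        (fun y => |(fderiv ℝ Θ.symm y).det| • η (Θ.symm y) • f (Θ.symm y)) y = 0 := by
      intro y hy
      by_cases hyB : y ∈ H ∩ B
      · have hχ : χ y = 0 := by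
          refine χ.zero_of_le_dist ?_
          have : ¬ dist y (ι t₀) ≤ s := fun h => hy ⟨hyB.1, h⟩
          exact (not_le.mp this).le
        rw [indicator_of_mem hyB, hηΨ y hyB.2, hχ, zero_smul, smul_zero]
      · exact indicator_of_notMem hyB _
    refine hnear _ ?_ fun y hy => ?_
    · refine IsBoundedContDiffOn.isTangentiallyBounded ι hH hι ?_
        fun y hy => hzero y fun h => hy h.1
      refine IsBoundedContDiffOn.extend_zero hH isOpen_ball isClosed_closedBall
        (closedBall_subset_ball hsρ) ?_ fun y _ hy => hzero y fun h => hy h.2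
      have hHB : IsOpen (H ∩ B) := hH.inter isOpen_ball
      have hsub : H ∩ B ⊆ closedBall (ι t₀) ρ := inter_subset_right.trans ball_subset_closedBall
      have hcpt : ∀ {Y : Type} [NormedAddCommGroup Y] [NormedSpace ℝ Y]
          {a : EuclideanSpace ℝ (Fin n) → Y}, ContDiffOn ℝ ∞ a Θ.target →
          IsBoundedContDiffOn m (H ∩ B) a := fun ha =>
        isBoundedContDiffOn_of_isCompact Θ.open_target (ha.of_le (by exact_mod_cast le_top))
          (isCompact_closedBall _ _) hT hsub
      -- The absolute value is smooth here because the determinant never vanishes.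
      have hdet : ContDiffOn ℝ ∞ (fun y => |(fderiv ℝ Θ.symm y).det|) Θ.target := by
        refine ContDiffOn.norm ℝ (ContinuousLinearMap.contDiff_det.comp_contDiffOn
          (hΘ'.fderiv_of_isOpen Θ.open_target (by simp))) fun y hy => ?_
        refine det_fderiv_ne_zero_of_leftInverse (Θ := Θ)
          ((hΘ'.contDiffAt (Θ.open_target.mem_nhds hy)).differentiableAt (by simp))
          ((hΘ.contDiffAt (Θ.open_source.mem_nhds (Θ.map_target hy))).differentiableAt (by simp)) ?_
        filter_upwards [Θ.open_target.mem_nhds hy] with y' hy' using Θ.right_inv hy'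
      have hprod := (hcpt hdet).smul hHB ((hcpt χ.contDiff.contDiffOn).smul hHB
        (hf.comp hHB hΩo (hcpt hΘ') fun y hy => (hΩ y (hBT hy.2)).mpr hy.1))
      refine hprod.congr hHB fun y hy => ?_
      have hyB : y ∈ H ∩ B := hy
      simp only [indicator_of_mem hyB, hηΨ y hyB.2, Function.comp]
    · by_contra hlt
      refine hy (hzero y fun h => hlt ?_)
      have := h.2
      rw [mem_closedBall_iff_norm] at this
      exact this.trans hsr
  · have hnhds : Θ.source ∩ Θ ⁻¹' ball (ι t₀) (s / 2) ∈ 𝓝 x₀ := by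
      refine (Θ.isOpen_inter_preimage isOpen_ball).mem_nhds ⟨hx₀s, ?_⟩
      rw [mem_preimage, hx₀, Θ.right_inv ht₀]
      exact mem_ball_self (by positivity)
    obtain ⟨δ, hδ, hδs⟩ := Metric.mem_nhds_iff.mp hnhds
    obtain ⟨R, hR0, hR⟩ := hΩb.subset_ball_lt 0 x₀
    have hfar := contDiffAt_integral_newtonKernel_of_eq_zero (x₀ := x₀)
      (g := Ω.indicator fun y => (1 - η y) • f y) (δ := δ) (R := R) ?_ hδ hR0 (fun y hy => ?_)
      fun y hy => ?_
    · have hcomp : ContDiffAt ℝ ∞ (fun t => ∫ y, newtonKernel n (Θ.symm (ι t)) y •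
          Ω.indicator (fun y => (1 - η y) • f y) y) t₀ :=
        ContDiffAt.comp (f := fun t => Θ.symm (ι t)) (g := fun x => ∫ y, newtonKernel n x y •
          Ω.indicator (fun y => (1 - η y) • f y) y) t₀ hfar hΨι
      exact hcomp.of_le (by exact_mod_cast le_top)
    · rw [integrable_indicator_iff hΩo.measurableSet]
      exact IntegrableOn.of_bound hΩb.measure_lt_top hg₂m M
        ((ae_restrict_iff' hΩo.measurableSet).mpr (Eventually.of_forall hg₂b))
    · have hyS := hδs (mem_ball_iff_norm.mpr hy)
      have hyχ : Θ y ∈ ball (ι t₀) (s / 2) := hyS.2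
      have hyB : y ∈ Θ.symm '' B := by
        rw [hSB]
        exact mem_inter hyS.1
          (ball_subset_ball (show s / 2 ≤ ρ by linarith) hyχ : Θ y ∈ ball (ι t₀) ρ)
      have h1 : η y = 1 := by
        rw [hη, piecewise_eq_of_mem _ _ _ hyB]
        exact χ.one_of_mem_closedBall (ball_subset_closedBall hyχ)
      by_cases hyΩ : y ∈ Ω
      · rw [indicator_of_mem hyΩ, h1, sub_self, zero_smul]
      · exact indicator_of_notMem hyΩ _
    · refine indicator_of_notMem (fun h => ?_) _
      have := mem_ball_iff_norm.mp (hR h)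
      linarith

end NearField

theorem lemma3p6 {𝕜 : Type*} [RCLike 𝕜] (n : ℕ) (hn : 2 ≤ n) (m : ℕ)
    (Ω : Set (EuclideanSpace ℝ (Fin n))) (hΩ_open : IsOpen Ω)
    (hΩ_bdd : Bornology.IsBounded Ω) (hΩ_smooth : HasSmoothBoundary Ω)
    (f : EuclideanSpace ℝ (Fin n) → 𝕜) (hf : IsContDiffUpToBoundary m Ω f) :
    (∀ x ∈ closure Ω, IntegrableOn (fun y => newtonKernel n x y • f y) Ω) ∧
      IsContDiffOnBoundary (m + 1) Ω (newtonPotential Ω f) := by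
  have hfb := hf.isBoundedContDiffOn hΩ_bdd
  refine ⟨fun x _ => ?_, fun Φ hΦ t₀ ht₀ => ?_⟩
  · obtain ⟨C, hC⟩ := hfb.exists_norm_le
    exact integrableOn_newtonKernel_smul hn hΩ_open.measurableSet hΩ_bdd
      (hfb.1.continuousOn.aestronglyMeasurable hΩ_open.measurableSet) hC x
  -- A linear isomorphism moves the target of the chart into `ℝⁿ`, so that the change of variables
  -- stays within one space; the half space becomes `0 < (L y).2`, invariant under `ι`.
  · let L : EuclideanSpace ℝ (Fin n) ≃L[ℝ] EuclideanSpace ℝ (Fin (n - 1)) × ℝ :=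
      ContinuousLinearEquiv.ofFinrankEq (by simp; omega)
    let Θ := Φ.transHomeomorph L.symm.toHomeomorph
    let ι : EuclideanSpace ℝ (Fin (n - 1)) →L[ℝ] EuclideanSpace ℝ (Fin n) :=
      L.symm.toContinuousLinearMap.comp (ContinuousLinearMap.inl ℝ _ ℝ)
    have hLι : ∀ t, L (ι t) = (t, 0) := fun t => L.apply_symm_apply _
    have hΘt : ∀ y, y ∈ Θ.target ↔ L y ∈ Φ.target := fun y => Iff.rfl
    have hΘs : ∀ y, Θ.symm y = Φ.symm (L y) := fun y => rfl
    have h := contDiffAt_newtonPotential_chart hn ι Θ (H := {y | 0 < (L y).2}) (m := m) (f := f)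
      (Ω := Ω) (t₀ := t₀) (L.symm.contDiff.comp_contDiffOn hΦ.contDiffOn)
      (hΦ.contDiffOn_symm.comp L.contDiff.contDiffOn fun y hy => hy)
      (isOpen_lt continuous_const (continuous_snd.comp L.continuous))
      (fun y t => by simp [hLι]) hΩ_open hΩ_bdd (fun y hy => ?_) hfb ?_
    · simp only [hΘs, hLι] at h
      exact_mod_cast h.contDiffWithinAt
    · have hy' : L y ∈ Φ.target := hy
      rw [hΘs, hΦ.mem_iff _ (Φ.map_target hy'), Φ.right_inv hy']
      rfl
    · rw [hΘt, hLι]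
      exact ht₀
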